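/- **Setting.** Fix $T>0$ and integers $n,m_1,m_2\ge 0$. Let $A\in L^\infty(0,T;\mathbb R^{n\times n})$, $B_i\in L^\infty(0,T;\mathbb R^{n\times m_i})$, let $G\in\mathbb S^n$ (symmetric $n\times n$ matrices), $Q\in L^\infty(0,T;\mathbb S^n)$, $S_i\in L^\infty(0,T;\mathbb R^{m_i\times n})$, $R_{ij}\in L^\infty(0,T;\mathbb R^{m_i\times m_j})$ with $R_{ij}^\top=R_{ji}$ ($i,j=1,2$), and write $$B=(B_1,B_2),\qquad S=\begin{pmatrix}S_1\\S_2\end{pmatrix},\qquad R=\begin{pmatrix}R_{11}&R_{12}\\R_{21}&R_{22}\end{pmatrix}.$$ Assume that for some $\alpha>0$, $R_{11}(t)\ge\alpha I$ and $R_{22}(t)\le-\alpha I$ for a.e. $t\in[0,T]$. Let $(\Omega,\mathcal F,\mathbb P)$ be a probability space with a filtration $\mathbb F=\{\mathcal F_t\}_{t\ge0}$ (for instance the augmented natural filtration of a Brownian motion). For $0\le t<T$ let $\mathcal U_i[t,T]$ be the set of $\mathbb F$-progressively measurable processes $u:[t,T]\times\Omega\to\mathbb R^{m_i}$ with $\mathbb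 E\int_t^T|u(s)|^2ds<\infty$. For $x\in\mathbb R^n$ and $u_i\in\mathcal U_i[t,T]$ let $X$ be the solution of $$\dot X(s)=A(s)X(s)+B_1(s)u_1(s)+B_2(s)u_2(s),\quad s\in[t,T],\qquad X(t)=x,$$ and put $$J(t,x;u_1,u_2)=\mathbb E\Big\{\langle GX(T),X(T)\rangle+\int_t^T\Big\langle\begin{pmatrix}Q&S_1^\top&S_2^\top\\S_1&R_{11}&R_{12}\\S_2&R_{21}&R_{22}\end{pmatrix}\begin{pmatrix}X\\u_1\\u_2\end{pmatrix},\begin{pmatrix}X\\u_1\\u_2\end{pmatrix}\Big\rangle ds\Big\},$$ $$V^-(t,x)=\sup_{u_2\in\mathcal U_2[t,T]}\inf_{u_1\in\mathcal U_1[t,T]}J(t,x;u_1,u_2),\qquad V^+(t,x)=\inf_{u_1\in\mathcal U_1[t,T]}\sup_{u_2\in\mathcal U_2[t,T]}J(t,x;u_1,u_2).$$ Suppose that $V^-(t,x)$ and $V^+(t,x)$ are finite for all $t\in[0,T)$, $x\in\mathbb R^n$. **Statement.** The matrix $R(t)$ is invertible for a.e. $t\in[0,T]$, and the Riccati equation $$\dot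 P+PA+A^\top P+Q-(PB+S^\top)R^{-1}(B^\top P+S)=0,\qquad P(T)=G,$$ has a unique solution $P\in C([0,T];\mathbb S^n)$. The Hamiltonian system $$\dot{\boldsymbol x}(s)=\begin{pmatrix}A-BR^{-1}S&-BR^{-1}B^\top\\-(Q-S^\top R^{-1}S)&-(A-BR^{-1}S)^\top\end{pmatrix}\boldsymbol x(s),\quad s\in[0,T],$$ has a fundamental matrix, and for every fundamental matrix $\Psi$ of it (a $2n\times2n$ matrix solution with $\Psi(0)$ invertible) and every $t\in[0,T]$: the matrix $\Psi(t)$ is invertible, the $n\times n$ matrix $$\Lambda(t)=(G,-I_n)\,\Psi(T)\Psi(t)^{-1}\begin{pmatrix}0\\I_n\end{pmatrix}$$ is invertible, and $$P(t)=-\Lambda(t)^{-1}(G,-I_n)\,\Psi(T)\Psi(t)^{-1}\begin{pmatrix}I_n\\0\end{pmatrix}.$$ Here differential equations are understood in the Carathéodory sense (absolutely continuous solutions, equation satisfied almost everywhere). -/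

import Mathlib

open MeasureTheory ProbabilityTheory Set Matrix
open scoped NNReal ENNReal

/-- `f ∈ L^∞(0,T; ℝ^{a×b})`: the entries of `f` are Lebesgue measurable and essentially bounded
on `[0,T]`. -/
def MatLInfty {a b : Type*} (T : ℝ) (f : ℝ → Matrix a b ℝ) : Prop :=
  ∀ i j, MemLp (fun t => f t i j) ∞ (volume.restrict (Icc 0 T))

/-- `M ≫ N`: for some `α > 0`, `M(t) - N(t) ≥ α I` for almost every `t ∈ [0,T]`, where `≥` is the
order of symmetric matrices. -/
def MatStrictlyAbove {m : ℕ} (T : ℝ) (M N : ℝ → Matrix (Fin m) (Fin m) ℝ) : Prop :=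
  ∃ α : ℝ, 0 < α ∧ ∀ᵐ t ∂(volume.restrict (Icc 0 T)),
    (M t - N t - α • (1 : Matrix (Fin m) (Fin m) ℝ)).PosSemidef

/-- `y` is a (Carathéodory) solution on `[a,b]` of the matrix equation `ẏ(s) = F(s, y(s))`:
it is continuous there, `F(s, y(s))` is integrable, and `y(s) = y(a) + ∫_a^s F(r, y(r)) dr`.
Equivalently, `y` is absolutely continuous and the equation holds almost everywhere. -/
def IsMatODESolution {ι κ : Type*} (a b : ℝ) (F : ℝ → Matrix ι κ ℝ → Matrix ι κ ℝ)
    (y : ℝ → Matrix ι κ ℝ) : Prop :=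
  ContinuousOn y (Icc a b) ∧
  (∀ i j, IntervalIntegrable (fun r => F r (y r) i j) volume a b) ∧
  ∀ s ∈ Icc a b, ∀ i j, y s i j = y a i j + ∫ r in a..s, F r (y r) i j

/-- The data of a two-person zero-sum linear-quadratic differential game without diffusion:
horizon `T`, coefficients `A, B₁, B₂` of the state equation, weights `G, Q, S_i, R_ij`. -/
structure LQGame (n m₁ m₂ : ℕ) where
  T : ℝ
  A : ℝ → Matrix (Fin n) (Fin n) ℝ
  B₁ : ℝ → Matrix (Fin n) (Fin m₁) ℝ
  B₂ : ℝ → Matrix (Fin n) (Fin m₂) ℝ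
  G : Matrix (Fin n) (Fin n) ℝ
  Q : ℝ → Matrix (Fin n) (Fin n) ℝ
  S₁ : ℝ → Matrix (Fin m₁) (Fin n) ℝ
  S₂ : ℝ → Matrix (Fin m₂) (Fin n) ℝ
  R₁₁ : ℝ → Matrix (Fin m₁) (Fin m₁) ℝ
  R₁₂ : ℝ → Matrix (Fin m₁) (Fin m₂) ℝ
  R₂₁ : ℝ → Matrix (Fin m₂) (Fin m₁) ℝ
  R₂₂ : ℝ → Matrix (Fin m₂) (Fin m₂) ℝ

namespace LQGame

variable {n m₁ m₂ : ℕ} (𝒢 : LQGame n m₁ m₂)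

/-- The standing assumptions: `0 < T`, bounded measurable coefficients and weights, symmetric
`G` and `Q`, and `R_ijᵀ = R_ji`. -/
structure Standing : Prop where
  T_pos : 0 < 𝒢.T
  A_bdd : MatLInfty 𝒢.T 𝒢.A
  B₁_bdd : MatLInfty 𝒢.T 𝒢.B₁
  B₂_bdd : MatLInfty 𝒢.T 𝒢.B₂
  G_symm : 𝒢.G.IsSymm
  Q_bdd : MatLInfty 𝒢.T 𝒢.Q
  Q_symm : ∀ᵐ t ∂(volume.restrict (Icc 0 𝒢.T)), (𝒢.Q t).IsSymm
  S₁_bdd : MatLInfty 𝒢.T 𝒢.S₁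
  S₂_bdd : MatLInfty 𝒢.T 𝒢.S₂
  R₁₁_bdd : MatLInfty 𝒢.T 𝒢.R₁₁
  R₁₂_bdd : MatLInfty 𝒢.T 𝒢.R₁₂
  R₂₁_bdd : MatLInfty 𝒢.T 𝒢.R₂₁
  R₂₂_bdd : MatLInfty 𝒢.T 𝒢.R₂₂
  R₁₁_symm : ∀ᵐ t ∂(volume.restrict (Icc 0 𝒢.T)), (𝒢.R₁₁ t).IsSymm
  R₂₂_symm : ∀ᵐ t ∂(volume.restrict (Icc 0 𝒢.T)), (𝒢.R₂₂ t).IsSymm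
  R₁₂_symm : ∀ᵐ t ∂(volume.restrict (Icc 0 𝒢.T)), (𝒢.R₁₂ t)ᵀ = 𝒢.R₂₁ t

/-- `B = (B₁, B₂)`. -/
def B (t : ℝ) : Matrix (Fin n) (Fin m₁ ⊕ Fin m₂) ℝ := fromCols (𝒢.B₁ t) (𝒢.B₂ t)

/-- `S = (S₁; S₂)`. -/
def S (t : ℝ) : Matrix (Fin m₁ ⊕ Fin m₂) (Fin n) ℝ := fromRows (𝒢.S₁ t) (𝒢.S₂ t)

/-- `R = (R₁₁, R₁₂; R₂₁, R₂₂)`. -/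
def R (t : ℝ) : Matrix (Fin m₁ ⊕ Fin m₂) (Fin m₁ ⊕ Fin m₂) ℝ :=
  fromBlocks (𝒢.R₁₁ t) (𝒢.R₁₂ t) (𝒢.R₂₁ t) (𝒢.R₂₂ t)

/-- `X` solves, on `[t,T]`, `Ẋ = A X + B₁ v₁ + B₂ v₂` with `X(t) = x`, for the given
input functions `v₁, v₂`. -/
def IsTrajectory (t : ℝ) (x : Fin n → ℝ) (v₁ : ℝ → Fin m₁ → ℝ) (v₂ : ℝ → Fin m₂ → ℝ)
    (X : ℝ → Fin n → ℝ) : Prop :=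
  ContinuousOn X (Icc t 𝒢.T) ∧
  IntervalIntegrable (fun r => 𝒢.A r *ᵥ X r + 𝒢.B₁ r *ᵥ v₁ r + 𝒢.B₂ r *ᵥ v₂ r) volume t 𝒢.T ∧
  ∀ s ∈ Icc t 𝒢.T,
    X s = x + ∫ r in t..s, (𝒢.A r *ᵥ X r + 𝒢.B₁ r *ᵥ v₁ r + 𝒢.B₂ r *ᵥ v₂ r)

open Classical in
/-- The trajectory on `[t,T]`; it exists and is unique on `[t,T]` whenever `v₁, v₂` are integrable
there (under the standing assumptions). -/
noncomputable def trajectory (t : ℝ) (x : Fin n → ℝ) (v₁ : ℝ → Fin m₁ → ℝ)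
    (v₂ : ℝ → Fin m₂ → ℝ) : ℝ → Fin n → ℝ :=
  if h : ∃ X, 𝒢.IsTrajectory t x v₁ v₂ X then h.choose else 0

/-- The running cost `⟨(Q, Sᵀ; S, R)(x, v₁, v₂), (x, v₁, v₂)⟩` at time `s`. -/
def runningCost (s : ℝ) (x : Fin n → ℝ) (v₁ : Fin m₁ → ℝ) (v₂ : Fin m₂ → ℝ) : ℝ :=
  let z : Fin n ⊕ (Fin m₁ ⊕ Fin m₂) → ℝ := Sum.elim x (Sum.elim v₁ v₂)
  (fromBlocks (𝒢.Q s) (𝒢.S s)ᵀ (𝒢.S s) (𝒢.R s) *ᵥ z) ⬝ᵥ z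

section Stochastic

variable {Ω : Type*} {mΩ : MeasurableSpace Ω} (μ : Measure Ω) (ℱ : Filtration ℝ≥0 mΩ)

/-- The controls `𝒰[t,T]` with values in `ℝ^m`: progressively measurable processes `u` with
`E ∫_t^T |u(s)|² ds < ∞`. Only the values on `[t,T]` enter the game; a process given on `[t,T]`
is extended by zero. -/
def Control (m : ℕ) (t : ℝ) : Set (ℝ → Ω → Fin m → ℝ) :=
  {u | IsStronglyProgressive ℱ (fun (s : ℝ≥0) ω => u s ω) ∧
    ∫⁻ ω, (∫⁻ s in Icc t 𝒢.T, ENNReal.ofReal (u s ω ⬝ᵥ u s ω)) ∂μ < ∞}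

/-- The state process with initial pair `(t,x)` under the controls `u₁, u₂`. -/
noncomputable def state (t : ℝ) (x : Fin n → ℝ) (u₁ : ℝ → Ω → Fin m₁ → ℝ)
    (u₂ : ℝ → Ω → Fin m₂ → ℝ) (s : ℝ) (ω : Ω) : Fin n → ℝ :=
  𝒢.trajectory t x (fun r => u₁ r ω) (fun r => u₂ r ω) s

/-- The quadratic functional `J(t,x;u₁,u₂)`. -/
noncomputable def J (t : ℝ) (x : Fin n → ℝ) (u₁ : ℝ → Ω → Fin m₁ → ℝ)
    (u₂ : ℝ → Ω → Fin m₂ → ℝ) : ℝ :=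
  ∫ ω, ((𝒢.G *ᵥ 𝒢.state t x u₁ u₂ 𝒢.T ω) ⬝ᵥ 𝒢.state t x u₁ u₂ 𝒢.T ω +
    ∫ s in t..𝒢.T, 𝒢.runningCost s (𝒢.state t x u₁ u₂ s ω) (u₁ s ω) (u₂ s ω)) ∂μ

/-- The open-loop lower value `V⁻(t,x) = sup_{u₂} inf_{u₁} J(t,x;u₁,u₂)`. -/
noncomputable def lowerValue (t : ℝ) (x : Fin n → ℝ) : EReal :=
  ⨆ u₂ ∈ 𝒢.Control μ ℱ m₂ t, ⨅ u₁ ∈ 𝒢.Control μ ℱ m₁ t, ((𝒢.J μ t x u₁ u₂ : ℝ) : EReal)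

/-- The open-loop upper value `V⁺(t,x) = inf_{u₁} sup_{u₂} J(t,x;u₁,u₂)`. -/
noncomputable def upperValue (t : ℝ) (x : Fin n → ℝ) : EReal :=
  ⨅ u₁ ∈ 𝒢.Control μ ℱ m₁ t, ⨆ u₂ ∈ 𝒢.Control μ ℱ m₂ t, ((𝒢.J μ t x u₁ u₂ : ℝ) : EReal)

/-- The open-loop lower and upper values are finite for every initial pair `(t,x)`. -/
def FiniteValues : Prop :=
  ∀ t ∈ Ico 0 𝒢.T, ∀ x : Fin n → ℝ,
    (𝒢.lowerValue μ ℱ t x ≠ ⊥ ∧ 𝒢.lowerValue μ ℱ t x ≠ ⊤) ∧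
    (𝒢.upperValue μ ℱ t x ≠ ⊥ ∧ 𝒢.upperValue μ ℱ t x ≠ ⊤)

end Stochastic

/-- `P ∈ C([0,T]; 𝕊ⁿ)` solves the Riccati equation
`Ṗ + P A + Aᵀ P + Q - (P B + Sᵀ) R⁻¹ (Bᵀ P + S) = 0`, `P(T) = G`. -/
def IsRiccatiSolution (P : ℝ → Matrix (Fin n) (Fin n) ℝ) : Prop :=
  (∀ t ∈ Icc 0 𝒢.T, (P t).IsSymm) ∧
  IsMatODESolution 0 𝒢.T
    (fun s p => -(p * 𝒢.A s + (𝒢.A s)ᵀ * p + 𝒢.Q s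
      - (p * 𝒢.B s + (𝒢.S s)ᵀ) * (𝒢.R s)⁻¹ * ((𝒢.B s)ᵀ * p + 𝒢.S s))) P ∧
  P 𝒢.T = 𝒢.G

/-- The coefficient matrix of the Hamiltonian system. -/
noncomputable def hamiltonian (s : ℝ) : Matrix (Fin n ⊕ Fin n) (Fin n ⊕ Fin n) ℝ :=
  fromBlocks
    (𝒢.A s - 𝒢.B s * (𝒢.R s)⁻¹ * 𝒢.S s)
    (-(𝒢.B s * (𝒢.R s)⁻¹ * (𝒢.B s)ᵀ))
    (-(𝒢.Q s - (𝒢.S s)ᵀ * (𝒢.R s)⁻¹ * 𝒢.S s))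
    (-(𝒢.A s - 𝒢.B s * (𝒢.R s)⁻¹ * 𝒢.S s)ᵀ)

/-- `Ψ` is a fundamental matrix of the Hamiltonian system on `[0,T]`: a matrix solution that is
nonsingular at time `0`. The choice `Ψ(0) = I` is a special case. -/
def IsFundamentalMatrix (Ψ : ℝ → Matrix (Fin n ⊕ Fin n) (Fin n ⊕ Fin n) ℝ) : Prop :=
  IsMatODESolution 0 𝒢.T (fun s M => 𝒢.hamiltonian s * M) Ψ ∧ IsUnit (Ψ 0)

/-- `Λ(t) = (G, -I) Ψ(T) Ψ(t)⁻¹ (0; I)`. -/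
noncomputable def Lam (Ψ : ℝ → Matrix (Fin n ⊕ Fin n) (Fin n ⊕ Fin n) ℝ) (t : ℝ) :
    Matrix (Fin n) (Fin n) ℝ :=
  fromCols 𝒢.G (-1 : Matrix (Fin n) (Fin n) ℝ) * (Ψ 𝒢.T * (Ψ t)⁻¹) *
    fromRows (0 : Matrix (Fin n) (Fin n) ℝ) (1 : Matrix (Fin n) (Fin n) ℝ)

end LQGame

/-!
# The Riccati equation of a deterministic linear-quadratic game with finite open-loop values

Stacking both controls into one vector `u`, the cost of a square-integrable control is the diagonal
of a symmetric bilinear form `b` on the space of pairs `(X, u)`, `Ẋ = A X + B u`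
(`LQGame.costForm`). The proof shows that `Λ(t)` is nonsingular for every `t`; the rest is linear
algebra and the calculus of absolutely continuous functions.

*Nonsingularity of `Λ(t)`.* If `Λ(t) η = 0`, the Hamiltonian system has a solution `(X, Y)` on
`[t,T]` with `X(t) = 0`, `Y(t) = η`, `Y(T) = G X(T)`. With `u = -R⁻¹ (Bᵀ Y + S X)`, integration by
parts gives `b((X, u), (X', u')) = ⟨η, X'(t)⟩` for every pair `(X', u')`
(`LQGame.exists_stationary_of_Lam_mulVec_eq_zero`). Split `(X, u) = p₁ + p₂`, where only player `i`
acts in `pᵢ` and both start at `0`.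
Perturbing a control of one player in a deterministic direction makes `J` a quadratic polynomial in
the step length (`LQGame.J_add_smul`), which must be bounded below for player one, since
`V⁻ ≠ -∞`, and bounded above for player two, since `V⁺ ≠ ∞`. Hence `b` is nonnegative on the
controls of player one and nonpositive on those of player two, and stationarity then forces
`b(p₁, p₁) = b(p₂, p₂) = b(p₁, p₂) = 0` and makes each `pᵢ` orthogonal to all controls
(`orthogonal_of_add_orthogonal`). The quadratic polynomial for a nonzero initial state `x` in
direction `pᵢ` is therefore affine, with slope `2 b(pᵢ, (X', 0))` where `X'(t) = x`; boundedness
makes the slope vanish (`LQGame.convex_of_lowerValue_ne_bot`,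
`LQGame.concave_of_upperValue_ne_top`). Adding up, `⟨η, x⟩ = 0` for all `x`, so `η = 0`.

*The Riccati equation.* The row `(G, -I) Ψ(T) Ψ⁻¹ = (Γ, Λ)` solves `Ẇ = -W H`, and
differentiating `-Λ⁻¹ Γ` gives the Riccati equation (`LQGame.isRiccatiSolution_of_isUnit_Lam`).
The difference of two solutions solves a linear homogeneous equation, whence uniqueness; symmetry
is uniqueness applied to the transpose.

The coefficients of the Hamiltonian system are bounded because `⟨R (a, b), (a, -b)⟩ ≥ α |(a, b)|²`,
which bounds `R⁻¹`. Fundamental matrices of linear systems with essentially bounded coefficients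
come from a contraction argument (`exists_caratheodory_solution`).
-/

/-! ### Carathéodory existence -/

/-- Carathéodory's existence theorem for right-hand sides that are Lipschitz in the state, with a
constant independent of time. -/
theorem exists_caratheodory_solution {E : Type*} [NormedAddCommGroup E] [NormedSpace ℝ E]
    [CompleteSpace E] {a b K : ℝ} (hab : a ≤ b) (hK : 0 ≤ K) (F : ℝ → E → E) (y₀ : E)
    (hint : ∀ y : ℝ → E, Continuous y → IntegrableOn (fun r => F r (y r)) (Icc a b))
    (hLip : ∀ᵐ r ∂(volume.restrict (Icc a b)), ∀ x y, ‖F r x - F r y‖ ≤ K * ‖x - y‖) :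
    ∃ y : ℝ → E, Continuous y ∧ ∀ s ∈ Icc a b, y s = y₀ + ∫ r in a..s, F r (y r) := by
  -- The weight `exp (k (s - a))` makes the integral operator a contraction with constant `1 / 2`.
  set k : ℝ := 2 * K + 1 with hk
  have hkpos : 0 < k := by positivity
  let lift (z : C(Icc a b, E)) (r : ℝ) : E := Real.exp (k * (r - a)) • IccExtend hab z r
  have hlift (z) : Continuous (lift z) := by
    have : Continuous (IccExtend hab z) := z.continuous.Icc_extend'
    fun_prop
  have hii (z) (s : ℝ) (hs : s ∈ Icc a b) :
      IntervalIntegrable (fun r => F r (lift z r)) volume a s :=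
    (intervalIntegrable_iff_integrableOn_Icc_of_le hs.1).2
      ((hint _ (hlift z)).mono_set (Icc_subset_Icc_right hs.2))
  have hcont (z) : ContinuousOn (fun s => ∫ r in a..s, F r (lift z r)) (Icc a b) := by
    have := intervalIntegral.continuousOn_primitive_interval (μ := volume)
      (f := fun r => F r (lift z r)) (a := a) (b := b)
      (by rw [uIcc_of_le hab]; exact hint _ (hlift z))
    rwa [uIcc_of_le hab] at this
  let T (z : C(Icc a b, E)) : C(Icc a b, E) :=
    ⟨fun s => Real.exp (-(k * (s - a))) • (y₀ + ∫ r in a..s, F r (lift z r)), by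
      have h := (hcont z).domRestrict
      have h' : Continuous fun s : Icc a b => ∫ r in a..(s : ℝ), F r (lift z r) := h
      fun_prop⟩
  have hTapp (z) (s : Icc a b) :
      T z s = Real.exp (-(k * (s - a))) • (y₀ + ∫ r in a..s, F r (lift z r)) := rfl
  have hcontr : ContractingWith (1 / 2) T := by
    refine ⟨by norm_num, LipschitzWith.of_dist_le_mul fun z w => ?_⟩
    rw [ContinuousMap.dist_le (by positivity)]
    intro s
    have hdiff : T z s - T w s =
        Real.exp (-(k * (s - a))) • ∫ r in a..s, (F r (lift z r) - F r (lift w r)) := by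
      rw [hTapp, hTapp, ← smul_sub,
        intervalIntegral.integral_sub (hii z s s.2) (hii w s s.2)]
      congr 1
      abel
    have hbound : ‖∫ r in a..s, (F r (lift z r) - F r (lift w r))‖ ≤
        ∫ r in a..s, K * (Real.exp (k * (r - a)) * dist z w) := by
      refine intervalIntegral.norm_integral_le_of_norm_le s.2.1 ?_
        (Continuous.intervalIntegrable (by fun_prop) _ _)
      filter_upwards [(ae_restrict_iff' measurableSet_Icc).1 hLip] with r hr hrs
      have hr' : r ∈ Icc a b := ⟨hrs.1.le, hrs.2.trans s.2.2⟩
      refine (hr hr' _ _).trans ?_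
      gcongr
      simp only [lift, ← smul_sub, norm_smul, Real.norm_eq_abs, Real.abs_exp]
      gcongr
      rw [IccExtend_of_mem _ _ hr', IccExtend_of_mem _ _ hr', ← dist_eq_norm]
      exact ContinuousMap.dist_apply_le_dist _
    have hexp : ∫ r in a..s, K * (Real.exp (k * (r - a)) * dist z w) =
        K * dist z w * ((Real.exp (k * (s - a)) - 1) / k) := by
      have : ∫ r in a..s, Real.exp (k * (r - a)) = (Real.exp (k * (s - a)) - 1) / k := by
        have hd : ∀ r ∈ uIcc a (s : ℝ),
            HasDerivAt (fun r => Real.exp (k * (r - a)) / k) (Real.exp (k * (r - a))) r := by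
          intro r _
          have h1 : HasDerivAt (fun r : ℝ => k * (r - a)) k r := by
            simpa using ((hasDerivAt_id r).sub_const a).const_mul k
          have := h1.exp.div_const k
          rwa [mul_div_assoc, div_self hkpos.ne', mul_one] at this
        rw [intervalIntegral.integral_eq_sub_of_hasDerivAt hd
          (Continuous.intervalIntegrable (by fun_prop) _ _)]
        simp [sub_div]
      rw [← this, ← intervalIntegral.integral_const_mul]
      congr 1
      ext r
      ring
    rw [dist_eq_norm, hdiff, norm_smul, Real.norm_eq_abs, Real.abs_exp]
    have hd0 : 0 ≤ dist z w := dist_nonneg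
    calc Real.exp (-(k * (s - a))) * ‖∫ r in a..s, (F r (lift z r) - F r (lift w r))‖
        ≤ Real.exp (-(k * (s - a))) * (K * dist z w * ((Real.exp (k * (s - a)) - 1) / k)) := by
          gcongr
          exact hbound.trans_eq hexp
      _ ≤ Real.exp (-(k * (s - a))) * (K * dist z w * (Real.exp (k * (s - a)) / k)) := by
          gcongr
          linarith
      _ = (K / k) * dist z w := by
          rw [Real.exp_neg]
          field_simp
      _ ≤ ((1 / 2 : ℝ≥0) : ℝ) * dist z w := by
          gcongr
          rw [div_le_iff₀ hkpos, hk]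
          push_cast
          linarith
  let z := ContractingWith.fixedPoint T hcontr
  have hz : T z = z := hcontr.fixedPoint_isFixedPt
  refine ⟨lift z, hlift z, fun s hs => ?_⟩
  have h1 : lift z s = Real.exp (k * (s - a)) • z ⟨s, hs⟩ := by
    simp only [lift]
    rw [IccExtend_of_mem _ _ hs]
  rw [h1]
  conv_lhs => rw [← hz, hTapp]
  rw [smul_smul, ← Real.exp_add]
  simp

/-! ### Calculus of primitives -/

/-- `f` is a primitive of the integrable function `φ` on `[a,b]`: it is absolutely continuous there
with derivative `φ` almost everywhere. -/
def IsPrimitiveOn (a b : ℝ) (f φ : ℝ → ℝ) : Prop :=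
  IntervalIntegrable φ volume a b ∧ ∀ s ∈ Icc a b, f s = f a + ∫ r in a..s, φ r

namespace IsPrimitiveOn

variable {a b : ℝ} {f g φ γ : ℝ → ℝ}

theorem intervalIntegrable (h : IsPrimitiveOn a b f φ) {s t : ℝ} (hs : s ∈ Icc a b)
    (ht : t ∈ Icc a b) : IntervalIntegrable φ volume s t := by
  refine h.1.mono_set ?_
  have hab := hs.1.trans hs.2
  rw [← uIcc_of_le hab] at hs ht
  exact uIcc_subset_uIcc hs ht

theorem sub_eq_integral (h : IsPrimitiveOn a b f φ) {s t : ℝ} (hs : s ∈ Icc a b)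
    (ht : t ∈ Icc a b) : f t - f s = ∫ r in s..t, φ r := by
  have ha : a ∈ Icc a b := ⟨le_rfl, hs.1.trans hs.2⟩
  rw [h.2 t ht, h.2 s hs, ← intervalIntegral.integral_add_adjacent_intervals
    (h.intervalIntegrable ha hs) (h.intervalIntegrable hs ht)]
  ring

theorem mono (h : IsPrimitiveOn a b f φ) {t : ℝ} (ht : t ∈ Icc a b) :
    IsPrimitiveOn t b f φ := by
  have hb : b ∈ Icc a b := ⟨ht.1.trans ht.2, le_rfl⟩
  refine ⟨h.intervalIntegrable ht hb, fun s hs => ?_⟩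
  rw [← h.sub_eq_integral ht ⟨ht.1.trans hs.1, hs.2⟩]
  ring

theorem continuousOn (hab : a ≤ b) (h : IsPrimitiveOn a b f φ) : ContinuousOn f (Icc a b) := by
  have := intervalIntegral.continuousOn_primitive_interval (μ := volume)
    (f := φ) (a := a) (b := b)
    (by rw [uIcc_of_le hab]; exact (intervalIntegrable_iff_integrableOn_Icc_of_le hab).1 h.1)
  rw [uIcc_of_le hab] at this
  exact (continuousOn_const (c := f a).add this).congr h.2

theorem const (c : ℝ) : IsPrimitiveOn a b (fun _ => c) (fun _ => 0) := by
  simp [IsPrimitiveOn]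

theorem add (hf : IsPrimitiveOn a b f φ) (hg : IsPrimitiveOn a b g γ) :
    IsPrimitiveOn a b (fun s => f s + g s) (fun s => φ s + γ s) := by
  refine ⟨hf.1.add hg.1, fun s hs => ?_⟩
  have ha : a ∈ Icc a b := ⟨le_rfl, hs.1.trans hs.2⟩
  beta_reduce
  rw [intervalIntegral.integral_add (hf.intervalIntegrable ha hs) (hg.intervalIntegrable ha hs),
    hf.2 s hs, hg.2 s hs]
  ring

theorem neg (hf : IsPrimitiveOn a b f φ) : IsPrimitiveOn a b (fun s => -f s) (fun s => -φ s) := by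
  refine ⟨hf.1.neg, fun s hs => ?_⟩
  beta_reduce
  rw [intervalIntegral.integral_neg, hf.2 s hs]
  ring

theorem sum {ι : Type*} (u : Finset ι) {f φ : ι → ℝ → ℝ}
    (h : ∀ i ∈ u, IsPrimitiveOn a b (f i) (φ i)) :
    IsPrimitiveOn a b (fun s => ∑ i ∈ u, f i s) (fun s => ∑ i ∈ u, φ i s) := by
  classical
  induction u using Finset.induction_on with
  | empty => simpa using const 0
  | insert i u hi ih =>
    simp only [Finset.sum_insert hi]
    exact (h i (by simp)).add (ih fun j hj => h j (by simp [hj]))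

theorem congr_ae (hab : a ≤ b) (h : IsPrimitiveOn a b f φ)
    (he : ∀ᵐ r ∂(volume.restrict (Icc a b)), φ r = γ r) : IsPrimitiveOn a b f γ := by
  refine ⟨?_, fun s hs => ?_⟩
  · rw [intervalIntegrable_iff_integrableOn_Icc_of_le hab]
    exact ((intervalIntegrable_iff_integrableOn_Icc_of_le hab).1 h.1).congr he
  · rw [h.2 s hs]
    congr 1
    refine intervalIntegral.integral_congr_ae ?_
    filter_upwards [(ae_restrict_iff' measurableSet_Icc).1 he] with r hr hrs
    rw [uIoc_of_le hs.1] at hrs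
    exact hr ⟨hrs.1.le, hrs.2.trans hs.2⟩

theorem congr (h : IsPrimitiveOn a b f φ) (he : ∀ s ∈ Icc a b, f s = g s) :
    IsPrimitiveOn a b g φ := by
  refine ⟨h.1, fun s hs => ?_⟩
  rw [← he s hs, ← he a ⟨le_rfl, hs.1.trans hs.2⟩, h.2 s hs]

theorem const_mul (c : ℝ) (h : IsPrimitiveOn a b f φ) :
    IsPrimitiveOn a b (fun s => c * f s) (fun s => c * φ s) := by
  refine ⟨h.1.const_mul c, fun s hs => ?_⟩
  beta_reduce
  rw [intervalIntegral.integral_const_mul, h.2 s hs]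
  ring

/-- Outside `[a,b]` the function `f` is arbitrary, so statements about derivatives at the endpoints
are made for an extension of `f` rather than for `f` itself. -/
theorem exists_absolutelyContinuousOnInterval (h : IsPrimitiveOn a b f φ) :
    ∃ F : ℝ → ℝ, AbsolutelyContinuousOnInterval F a b ∧ (∀ s ∈ Icc a b, F s = f s) ∧
      ∀ᵐ x, x ∈ uIcc a b → HasDerivAt F (φ x) x := by
  refine ⟨fun s => (∫ r in a..s, φ r) + f a, ?_, fun s hs => ?_, ?_⟩
  · have h1 := h.1.absolutelyContinuousOnInterval_intervalIntegral (c := a) (by simp)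
    have h2 : AbsolutelyContinuousOnInterval (fun _ : ℝ => f a) a b :=
      (LipschitzWith.const (f a)).lipschitzOnWith.absolutelyContinuousOnInterval
    exact h1.add h2
  · rw [h.2 s hs]
    ring
  · filter_upwards [h.1.ae_hasDerivAt_integral] with x hx hxm
    exact (hx hxm a (by simp)).add_const _

theorem mul (hab : a ≤ b) (hf : IsPrimitiveOn a b f φ) (hg : IsPrimitiveOn a b g γ) :
    IsPrimitiveOn a b (fun s => f s * g s) (fun s => φ s * g s + f s * γ s) := by
  have hfc := hf.continuousOn hab
  have hgc := hg.continuousOn hab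
  have hint : IntervalIntegrable (fun s => φ s * g s + f s * γ s) volume a b :=
    (hf.1.mul_continuousOn (by rwa [uIcc_of_le hab])).add
      (hg.1.continuousOn_mul (by rwa [uIcc_of_le hab]))
  refine ⟨hint, fun s hs => ?_⟩
  obtain ⟨F, hFac, hFe, hFd⟩ := hf.exists_absolutelyContinuousOnInterval
  obtain ⟨G, hGac, hGe, hGd⟩ := hg.exists_absolutelyContinuousOnInterval
  have ha : a ∈ Icc a b := ⟨le_rfl, hab⟩
  have hsub : uIcc a s ⊆ uIcc a b := by
    rw [uIcc_of_le hs.1, uIcc_of_le hab]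
    exact Icc_subset_Icc_right hs.2
  have key := (hFac.mono hsub).integral_deriv_mul_eq_sub (hGac.mono hsub)
  rw [hFe s hs, hGe s hs, hFe a ha, hGe a ha] at key
  have : ∫ r in a..s, (φ r * g r + f r * γ r) = ∫ r in a..s, (deriv F r * G r + F r * deriv G r) := by
    refine intervalIntegral.integral_congr_ae ?_
    filter_upwards [hFd, hGd] with r h1 h2 hr
    have hr' : r ∈ uIcc a b := hsub (uIoc_subset_uIcc hr)
    have hr'' : r ∈ Icc a b := by rwa [uIcc_of_le hab] at hr'
    rw [(h1 hr').deriv, (h2 hr').deriv, hFe r hr'', hGe r hr'']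
  rw [this, key]
  ring

end IsPrimitiveOn

/-- The entrywise version of `IsPrimitiveOn` for matrix-valued functions. -/
def IsMatPrimitiveOn {ι κ : Type*} (a b : ℝ) (M M' : ℝ → Matrix ι κ ℝ) : Prop :=
  ∀ i j, IsPrimitiveOn a b (fun s => M s i j) (fun s => M' s i j)

namespace IsMatPrimitiveOn

variable {ι κ l : Type*} {a b : ℝ} {M M' : ℝ → Matrix ι κ ℝ}

theorem const (C : Matrix ι κ ℝ) : IsMatPrimitiveOn a b (fun _ => C) (fun _ => 0) :=
  fun i j => IsPrimitiveOn.const (C i j)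

theorem add {N N' : ℝ → Matrix ι κ ℝ} (hM : IsMatPrimitiveOn a b M M')
    (hN : IsMatPrimitiveOn a b N N') :
    IsMatPrimitiveOn a b (fun s => M s + N s) (fun s => M' s + N' s) :=
  fun i j => (hM i j).add (hN i j)

theorem neg (hM : IsMatPrimitiveOn a b M M') :
    IsMatPrimitiveOn a b (fun s => -M s) (fun s => -M' s) :=
  fun i j => (hM i j).neg

theorem transpose (hM : IsMatPrimitiveOn a b M M') :
    IsMatPrimitiveOn a b (fun s => (M s)ᵀ) (fun s => (M' s)ᵀ) :=
  fun i j => hM j i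

theorem mul [Fintype κ] {N N' : ℝ → Matrix κ l ℝ} (hab : a ≤ b) (hM : IsMatPrimitiveOn a b M M')
    (hN : IsMatPrimitiveOn a b N N') :
    IsMatPrimitiveOn a b (fun s => M s * N s) (fun s => M' s * N s + M s * N' s) := by
  intro i j
  have := IsPrimitiveOn.sum Finset.univ fun k _ => (hM i k).mul hab (hN k j)
  simpa only [Matrix.add_apply, Matrix.mul_apply, ← Finset.sum_add_distrib] using this

theorem mono (h : IsMatPrimitiveOn a b M M') {t : ℝ} (ht : t ∈ Icc a b) :
    IsMatPrimitiveOn t b M M' :=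
  fun i j => (h i j).mono ht

theorem congr_ae {N' : ℝ → Matrix ι κ ℝ} (hab : a ≤ b) (h : IsMatPrimitiveOn a b M M')
    (he : ∀ᵐ r ∂(volume.restrict (Icc a b)), M' r = N' r) : IsMatPrimitiveOn a b M N' :=
  fun i j => (h i j).congr_ae hab (he.mono fun r hr => by rw [hr])

theorem congr {N : ℝ → Matrix ι κ ℝ} (h : IsMatPrimitiveOn a b M M')
    (he : ∀ s ∈ Icc a b, M s = N s) : IsMatPrimitiveOn a b N M' :=
  fun i j => (h i j).congr fun s hs => by rw [he s hs]

theorem continuousOn (hab : a ≤ b) (h : IsMatPrimitiveOn a b M M') :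
    ContinuousOn M (Icc a b) :=
  continuousOn_pi.2 fun i => continuousOn_pi.2 fun j => (h i j).continuousOn hab

theorem eq_of_deriv_eq_zero (hab : a ≤ b) (h : IsMatPrimitiveOn a b M M')
    (h0 : ∀ᵐ r ∂(volume.restrict (Icc a b)), M' r = 0) {s t : ℝ} (hs : s ∈ Icc a b)
    (ht : t ∈ Icc a b) : M s = M t := by
  have h1 : IsMatPrimitiveOn a b M (fun _ => 0) := h.congr_ae hab h0
  ext i j
  simpa using (h1 i j).sub_eq_integral ht hs |> sub_eq_zero.1 ∘ fun h => h.trans (by simp)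

theorem isMatODESolution_iff (hab : a ≤ b) {F : ℝ → Matrix ι κ ℝ → Matrix ι κ ℝ} :
    IsMatODESolution a b F M ↔ IsMatPrimitiveOn a b M (fun s => F s (M s)) :=
  ⟨fun h i j => ⟨h.2.1 i j, fun s hs => h.2.2 s hs i j⟩,
    fun h => ⟨h.continuousOn hab, fun i j => (h i j).1, fun s hs i j => (h i j).2 s hs⟩⟩

end IsMatPrimitiveOn

/-- The entrywise version of `IsPrimitiveOn` for vector-valued functions. -/
def IsVecPrimitiveOn {ι : Type*} (a b : ℝ) (y y' : ℝ → ι → ℝ) : Prop :=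
  ∀ i, IsPrimitiveOn a b (fun s => y s i) (fun s => y' s i)

namespace IsVecPrimitiveOn

variable {ι κ : Type*} {a b : ℝ} {y y' : ℝ → ι → ℝ}

theorem add {z z' : ℝ → ι → ℝ} (hy : IsVecPrimitiveOn a b y y') (hz : IsVecPrimitiveOn a b z z') :
    IsVecPrimitiveOn a b (fun s => y s + z s) (fun s => y' s + z' s) :=
  fun i => (hy i).add (hz i)

theorem congr_ae {z' : ℝ → ι → ℝ} (hab : a ≤ b) (h : IsVecPrimitiveOn a b y y')
    (he : ∀ᵐ r ∂(volume.restrict (Icc a b)), y' r = z' r) : IsVecPrimitiveOn a b y z' :=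
  fun i => (h i).congr_ae hab (he.mono fun r hr => by rw [hr])

theorem continuousOn (hab : a ≤ b) (h : IsVecPrimitiveOn a b y y') : ContinuousOn y (Icc a b) :=
  continuousOn_pi.2 fun i => (h i).continuousOn hab

theorem mulVec [Fintype ι] {M M' : ℝ → Matrix κ ι ℝ} (hab : a ≤ b) (hM : IsMatPrimitiveOn a b M M')
    (hy : IsVecPrimitiveOn a b y y') :
    IsVecPrimitiveOn a b (fun s => M s *ᵥ y s) (fun s => M' s *ᵥ y s + M s *ᵥ y' s) := by
  intro i
  have := IsPrimitiveOn.sum Finset.univ fun k _ => (hM i k).mul hab (hy k)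
  simpa only [Pi.add_apply, Matrix.mulVec, dotProduct, ← Finset.sum_add_distrib] using this

theorem dotProduct [Fintype ι] {z z' : ℝ → ι → ℝ} (hab : a ≤ b) (hy : IsVecPrimitiveOn a b y y')
    (hz : IsVecPrimitiveOn a b z z') :
    IsPrimitiveOn a b (fun s => y s ⬝ᵥ z s) (fun s => y' s ⬝ᵥ z s + y s ⬝ᵥ z' s) := by
  have := IsPrimitiveOn.sum Finset.univ fun k _ => (hy k).mul hab (hz k)
  simpa only [_root_.dotProduct, ← Finset.sum_add_distrib] using this

end IsVecPrimitiveOn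

/-! ### Essentially bounded matrix functions -/

theorem memLp_of_continuousOn_Icc {a b : ℝ} {f : ℝ → ℝ} (hf : ContinuousOn f (Icc a b))
    (p : ℝ≥0∞) : MemLp f p (volume.restrict (Icc a b)) := by
  obtain ⟨C, hC⟩ := isCompact_Icc.exists_bound_of_continuousOn hf
  exact MemLp.of_bound (hf.aestronglyMeasurable measurableSet_Icc) C
    ((ae_restrict_iff' measurableSet_Icc).2 (.of_forall hC))

namespace MatLInfty

variable {ι κ l : Type*} {T : ℝ}

theorem add {f g : ℝ → Matrix ι κ ℝ} (hf : MatLInfty T f) (hg : MatLInfty T g) :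
    MatLInfty T (fun t => f t + g t) :=
  fun i j => (hf i j).add (hg i j)

theorem sub {f g : ℝ → Matrix ι κ ℝ} (hf : MatLInfty T f) (hg : MatLInfty T g) :
    MatLInfty T (fun t => f t - g t) :=
  fun i j => (hf i j).sub (hg i j)

theorem neg {f : ℝ → Matrix ι κ ℝ} (hf : MatLInfty T f) : MatLInfty T (fun t => -f t) :=
  fun i j => (hf i j).neg

theorem transpose {f : ℝ → Matrix ι κ ℝ} (hf : MatLInfty T f) : MatLInfty T (fun t => (f t)ᵀ) :=
  fun i j => hf j i

theorem mul [Fintype κ] {f : ℝ → Matrix ι κ ℝ} {g : ℝ → Matrix κ l ℝ} (hf : MatLInfty T f)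
    (hg : MatLInfty T g) : MatLInfty T (fun t => f t * g t) := by
  intro i j
  simp only [Matrix.mul_apply]
  exact memLp_finsetSum _ fun k _ => (hg k j).mul (hf i k)

theorem fromCols {κ' : Type*} {f : ℝ → Matrix ι κ ℝ} {g : ℝ → Matrix ι κ' ℝ}
    (hf : MatLInfty T f) (hg : MatLInfty T g) :
    MatLInfty T (fun t => Matrix.fromCols (f t) (g t)) := by
  rintro i (j | j)
  · exact hf i j
  · exact hg i j

theorem fromRows {ι' : Type*} {f : ℝ → Matrix ι κ ℝ} {g : ℝ → Matrix ι' κ ℝ}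
    (hf : MatLInfty T f) (hg : MatLInfty T g) :
    MatLInfty T (fun t => Matrix.fromRows (f t) (g t)) := by
  rintro (i | i) j
  · exact hf i j
  · exact hg i j

theorem fromBlocks {ι' κ' : Type*} {f : ℝ → Matrix ι κ ℝ} {g : ℝ → Matrix ι κ' ℝ}
    {f' : ℝ → Matrix ι' κ ℝ} {g' : ℝ → Matrix ι' κ' ℝ}
    (hf : MatLInfty T f) (hg : MatLInfty T g) (hf' : MatLInfty T f') (hg' : MatLInfty T g') :
    MatLInfty T (fun t => Matrix.fromBlocks (f t) (g t) (f' t) (g' t)) := by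
  rintro (i | i) (j | j)
  · exact hf i j
  · exact hg i j
  · exact hf' i j
  · exact hg' i j

theorem of_continuousOn {f : ℝ → Matrix ι κ ℝ} (hf : ContinuousOn f (Icc 0 T)) :
    MatLInfty T f :=
  fun i j => memLp_of_continuousOn_Icc (continuousOn_pi.1 (continuousOn_pi.1 hf i) j) ∞

theorem exists_bound [Finite ι] [Finite κ] {f : ℝ → Matrix ι κ ℝ} (hf : MatLInfty T f) :
    ∃ C : ℝ, 0 ≤ C ∧ ∀ᵐ t ∂(volume.restrict (Icc 0 T)), ∀ i j, |f t i j| ≤ C := by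
  classical
  cases nonempty_fintype ι
  cases nonempty_fintype κ
  let c (i j) : ℝ := (eLpNorm (fun t => f t i j) ∞ (volume.restrict (Icc 0 T))).toReal
  have hc (i j) : 0 ≤ c i j := ENNReal.toReal_nonneg
  refine ⟨∑ i, ∑ j, c i j, Finset.sum_nonneg fun i _ => Finset.sum_nonneg fun j _ => hc i j, ?_⟩
  rw [ae_all_iff]
  intro i
  rw [ae_all_iff]
  intro j
  have h := ae_le_eLpNormEssSup (f := fun t => f t i j) (μ := volume.restrict (Icc 0 T))
  filter_upwards [h] with t ht
  have h1 : |f t i j| ≤ c i j := by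
    rw [← eLpNorm_exponent_top] at ht
    have := ENNReal.toReal_mono (hf i j).eLpNorm_lt_top.ne ht
    rwa [toReal_enorm, Real.norm_eq_abs] at this
  calc |f t i j| ≤ c i j := h1
    _ ≤ ∑ j, c i j := Finset.single_le_sum (fun j _ => hc i j) (Finset.mem_univ j)
    _ ≤ ∑ i, ∑ j, c i j := Finset.single_le_sum (f := fun i => ∑ j, c i j)
        (fun i _ => Finset.sum_nonneg fun j _ => hc i j) (Finset.mem_univ i)

end MatLInfty

theorem norm_mulVec_le_of_abs_le {ι κ : Type*} [Fintype ι] [Fintype κ] {M : Matrix ι κ ℝ} {C : ℝ}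
    (hC : 0 ≤ C) (hM : ∀ i j, |M i j| ≤ C) (v : κ → ℝ) :
    ‖M *ᵥ v‖ ≤ C * Fintype.card κ * ‖v‖ := by
  rw [pi_norm_le_iff_of_nonneg (by positivity)]
  intro i
  calc ‖(M *ᵥ v) i‖ ≤ ∑ j, ‖M i j * v j‖ := norm_sum_le _ _
    _ ≤ ∑ _j : κ, C * ‖v‖ := by
        refine Finset.sum_le_sum fun j _ => ?_
        rw [norm_mul]
        exact mul_le_mul (hM i j) (norm_le_pi_norm v j) (norm_nonneg _) hC
    _ = C * Fintype.card κ * ‖v‖ := by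
        simp
        ring

/-! ### Linear matrix equations with essentially bounded coefficients -/

section Linear

variable {ι κ : Type*} [Fintype ι] {T : ℝ}

theorem exists_linear_solution {A : ℝ → Matrix ι ι ℝ} (hT : 0 ≤ T) (hA : MatLInfty T A)
    (C : Matrix ι κ ℝ) :
    ∃ Φ : ℝ → Matrix ι κ ℝ, IsMatPrimitiveOn 0 T Φ (fun s => A s * Φ s) ∧ Φ 0 = C := by
  classical
  obtain ⟨c, hc, hb⟩ := hA.exists_bound
  have hint (y : ℝ → ι → ℝ) (hy : Continuous y) :
      IntegrableOn (fun r => A r *ᵥ y r) (Icc 0 T) := by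
    refine Integrable.of_eval fun i => ?_
    simp only [mulVec, dotProduct]
    refine integrable_finsetSum _ fun k _ => ?_
    have h1 : IntegrableOn (fun r => A r i k) (Icc 0 T) := (hA i k).integrable le_top
    exact h1.mul_continuousOn (by fun_prop) isCompact_Icc
  have hcol (j : κ) := exists_caratheodory_solution (K := c * Fintype.card ι) hT (by positivity)
    (fun r (y : ι → ℝ) => A r *ᵥ y) (fun i => C i j) hint (by
      filter_upwards [hb] with r hr x y
      rw [← mulVec_sub]
      exact norm_mulVec_le_of_abs_le hc hr _)
  choose y hyc hy using hcol
  refine ⟨fun s => Matrix.of fun i j => y j s i, fun i j => ⟨?_, fun s hs => ?_⟩, ?_⟩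
  · rw [intervalIntegrable_iff_integrableOn_Icc_of_le hT]
    exact (hint _ (hyc j)).eval i
  · have hii : IntervalIntegrable (fun r => A r *ᵥ y j r) volume 0 s :=
      (intervalIntegrable_iff_integrableOn_Icc_of_le hs.1).2
        ((hint _ (hyc j)).mono_set (Icc_subset_Icc_right hs.2))
    have h0 := hy j 0 ⟨le_rfl, hT⟩
    simp only [intervalIntegral.integral_same, add_zero] at h0
    simp only [Matrix.of_apply]
    rw [hy j s hs, h0]
    simp only [Pi.add_apply]
    congr 1
    exact (ContinuousLinearMap.proj (R := ℝ) (φ := fun _ : ι => ℝ) i).intervalIntegral_comp_comm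
      hii |>.symm
  · ext i j
    simpa using congrFun (hy j 0 ⟨le_rfl, hT⟩) i

theorem exists_linear_solution_right {A : ℝ → Matrix ι ι ℝ} (hT : 0 ≤ T) (hA : MatLInfty T A)
    (C : Matrix κ ι ℝ) :
    ∃ Z : ℝ → Matrix κ ι ℝ, IsMatPrimitiveOn 0 T Z (fun s => -(Z s * A s)) ∧ Z 0 = C := by
  obtain ⟨Φ, hΦ, h0⟩ := exists_linear_solution hT hA.transpose.neg Cᵀ
  refine ⟨fun s => (Φ s)ᵀ, ?_, by simp [h0]⟩
  convert hΦ.transpose using 2 with s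
  simp [transpose_mul]

/-- A solution of `Ṁ = A M` and a solution of `Ż = -Z A` have a constant product `Z M`. -/
theorem mul_eq_mul_of_linear {κ' : Type*} {A : ℝ → Matrix ι ι ℝ} (hT : 0 ≤ T)
    {Z : ℝ → Matrix κ' ι ℝ} {M : ℝ → Matrix ι κ ℝ}
    (hZ : IsMatPrimitiveOn 0 T Z (fun s => -(Z s * A s)))
    (hM : IsMatPrimitiveOn 0 T M (fun s => A s * M s)) {s t : ℝ} (hs : s ∈ Icc 0 T)
    (ht : t ∈ Icc 0 T) : Z s * M s = Z t * M t :=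
  (hZ.mul hT hM).eq_of_deriv_eq_zero hT (.of_forall fun r => by simp [Matrix.mul_assoc]) hs ht

/-- A fundamental matrix of a linear system stays nonsingular, and its inverse solves the adjoint
system `Ż = -Z A`. -/
theorem inv_of_linear [DecidableEq ι] {A Ψ : ℝ → Matrix ι ι ℝ} (hT : 0 ≤ T) (hA : MatLInfty T A)
    (hΨ : IsMatPrimitiveOn 0 T Ψ (fun s => A s * Ψ s)) (h0 : IsUnit (Ψ 0)) :
    (∀ s ∈ Icc 0 T, IsUnit (Ψ s)) ∧ ∃ Z : ℝ → Matrix ι ι ℝ, (∀ s ∈ Icc 0 T, Z s = (Ψ s)⁻¹) ∧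
      IsMatPrimitiveOn 0 T Z (fun s => -(Z s * A s)) := by
  obtain ⟨Z, hZ, hZ0⟩ := exists_linear_solution_right hT hA (Ψ 0)⁻¹
  have h1 : ∀ s ∈ Icc 0 T, Z s * Ψ s = 1 := by
    intro s hs
    rw [mul_eq_mul_of_linear hT hZ hΨ hs ⟨le_rfl, hT⟩, hZ0]
    exact nonsing_inv_mul _ ((isUnit_iff_isUnit_det _).1 h0)
  refine ⟨fun s hs => ?_, Z, fun s hs => (inv_eq_left_inv (h1 s hs)).symm, hZ⟩
  exact IsUnit.of_mul_eq_one _ (mul_eq_one_comm.1 (h1 s hs))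

/-- A solution of the homogeneous equation `Ḋ = D a + b D` that vanishes at time `T` vanishes
identically. -/
theorem eq_zero_of_sylvester {κ : Type*} [Fintype κ] {D : ℝ → Matrix ι κ ℝ}
    {α : ℝ → Matrix κ κ ℝ} {β : ℝ → Matrix ι ι ℝ} (hT : 0 ≤ T) (hα : MatLInfty T α)
    (hβ : MatLInfty T β) (hD : IsMatPrimitiveOn 0 T D (fun s => D s * α s + β s * D s))
    (hDT : D T = 0) {s : ℝ} (hs : s ∈ Icc 0 T) : D s = 0 := by
  classical
  obtain ⟨N, hN, hN0⟩ := exists_linear_solution hT hα.neg (1 : Matrix κ κ ℝ)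
  obtain ⟨Z, hZ, hZ0⟩ := exists_linear_solution_right hT hβ (1 : Matrix ι ι ℝ)
  have hNu := (inv_of_linear hT hα.neg hN (by simp [hN0])).1 s hs
  have hZt : IsMatPrimitiveOn 0 T (fun s => (Z s)ᵀ) (fun s => -(β s)ᵀ * (Z s)ᵀ) := by
    convert hZ.transpose using 2 with s
    simp [transpose_mul]
  have hZu : IsUnit (Z s)ᵀ :=
    (inv_of_linear hT hβ.transpose.neg hZt (by simp [hZ0])).1 s hs
  have hZu' : IsUnit (Z s) := by simpa using (Matrix.isUnit_transpose (Z s)).1 hZu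
  have hconst := ((hZ.mul hT hD).mul hT hN).eq_of_deriv_eq_zero hT
    (.of_forall fun r => by
      simp only [Matrix.mul_add, Matrix.add_mul, Matrix.mul_assoc, Matrix.neg_mul, Matrix.mul_neg]
      abel) hs ⟨hT, le_rfl⟩
  rw [hDT, Matrix.mul_zero, Matrix.zero_mul] at hconst
  rw [isUnit_iff_isUnit_det] at hNu hZu'
  calc D s = (Z s)⁻¹ * (Z s * D s * N s) * (N s)⁻¹ := by
        rw [← Matrix.mul_assoc, mul_nonsing_inv_cancel_right _ _ hNu,
          nonsing_inv_mul_cancel_left _ _ hZu']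
    _ = 0 := by rw [hconst]; simp

end Linear

/-! ### The weight matrix `R` -/

/-- A symmetric block matrix whose diagonal blocks are bounded below by `α` and above by `-α` is
coercive when tested against `(a, -b)`, so the off-diagonal blocks play no role. -/
theorem indefinite_block_coercive {m₁ m₂ : ℕ} {α : ℝ} {R₁₁ : Matrix (Fin m₁) (Fin m₁) ℝ}
    {R₁₂ : Matrix (Fin m₁) (Fin m₂) ℝ} {R₂₂ : Matrix (Fin m₂) (Fin m₂) ℝ}
    (h₁ : (R₁₁ - α • (1 : Matrix (Fin m₁) (Fin m₁) ℝ)).PosSemidef)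
    (h₂ : (-R₂₂ - α • (1 : Matrix (Fin m₂) (Fin m₂) ℝ)).PosSemidef)
    (a : Fin m₁ → ℝ) (b : Fin m₂ → ℝ) :
    α * (Sum.elim a b ⬝ᵥ Sum.elim a b) ≤
      Sum.elim a (-b) ⬝ᵥ fromBlocks R₁₁ R₁₂ R₁₂ᵀ R₂₂ *ᵥ Sum.elim a b := by
  have e₁ := h₁.dotProduct_mulVec_nonneg a
  have e₂ := h₂.dotProduct_mulVec_nonneg b
  simp only [star_trivial, sub_mulVec, neg_mulVec, smul_mulVec, one_mulVec, dotProduct_sub,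
    dotProduct_neg, dotProduct_smul, smul_eq_mul] at e₁ e₂
  rw [fromBlocks_mulVec, sumElim_dotProduct_sumElim, sumElim_dotProduct_sumElim]
  simp only [Sum.elim_comp_inl, Sum.elim_comp_inr, dotProduct_add, neg_dotProduct]
  have e₃ : b ⬝ᵥ R₁₂ᵀ *ᵥ a = a ⬝ᵥ R₁₂ *ᵥ b := by
    rw [mulVec_transpose, dotProduct_comm b, ← dotProduct_mulVec]
  rw [e₃]
  linarith

theorem isUnit_and_abs_inv_le_of_coercive {m₁ m₂ : ℕ} {α : ℝ} (hα : 0 < α)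
    {R : Matrix (Fin m₁ ⊕ Fin m₂) (Fin m₁ ⊕ Fin m₂) ℝ}
    (h : ∀ (a : Fin m₁ → ℝ) (b : Fin m₂ → ℝ),
      α * (Sum.elim a b ⬝ᵥ Sum.elim a b) ≤ Sum.elim a (-b) ⬝ᵥ R *ᵥ Sum.elim a b) :
    IsUnit R ∧ ∀ i j, |R⁻¹ i j| ≤ α⁻¹ := by
  have hu : IsUnit R := by
    rw [← mulVec_injective_iff_isUnit]
    refine (injective_iff_map_eq_zero (Matrix.mulVecLin R)).2 fun z hz => ?_
    rw [mulVecLin_apply] at hz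
    have := h (z ∘ Sum.inl) (z ∘ Sum.inr)
    rw [Sum.elim_comp_inl_inr, hz, dotProduct_zero] at this
    have h0 : 0 ≤ z ⬝ᵥ z := Finset.sum_nonneg fun k _ => mul_self_nonneg _
    exact dotProduct_self_eq_zero.1 (le_antisymm (by nlinarith) h0)
  refine ⟨hu, fun i j => ?_⟩
  set z : Fin m₁ ⊕ Fin m₂ → ℝ := fun k => R⁻¹ k j with hz
  have hRz : R *ᵥ z = Pi.single j 1 := by
    have : z = R⁻¹ *ᵥ Pi.single j 1 := by
      ext k
      simp [hz]
    rw [this, mulVec_mulVec, mul_nonsing_inv _ ((isUnit_iff_isUnit_det _).1 hu), one_mulVec]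
  have key : α * (z ⬝ᵥ z) ≤ |z j| := by
    have := h (z ∘ Sum.inl) (z ∘ Sum.inr)
    rw [Sum.elim_comp_inl_inr, hRz, dotProduct_single, mul_one] at this
    refine this.trans ?_
    rcases j with j | j
    · exact le_abs_self _
    · exact neg_le_abs _
  have hle (k) : z k * z k ≤ z ⬝ᵥ z :=
    Finset.single_le_sum (f := fun k => z k * z k) (fun k _ => mul_self_nonneg _)
      (Finset.mem_univ k)
  have hk (k) : α * |z k| * |z k| ≤ |z j| := by
    have := mul_le_mul_of_nonneg_left (hle k) hα.le
    rw [← abs_mul_abs_self] at this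
    linarith
  have hj : α * |z j| ≤ 1 := by
    by_contra! hcon
    have hpos : 0 < |z j| := by
      by_contra! h'
      nlinarith [abs_nonneg (z j)]
    nlinarith [hk j]
  have hi : (α * |z i|) * (α * |z i|) ≤ 1 * 1 := by
    nlinarith [hk i, abs_nonneg (z i)]
  have := abs_le_of_sq_le_sq' (a := α * |z i|) (b := 1) (by nlinarith) zero_le_one
  change |z i| ≤ α⁻¹
  rw [← one_div, le_div_iff₀ hα, mul_comm]
  exact this.2

theorem MatLInfty.inv {ι : Type*} [Fintype ι] [DecidableEq ι] {T c : ℝ} {f : ℝ → Matrix ι ι ℝ}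
    (hf : MatLInfty T f) (hc : ∀ᵐ t ∂(volume.restrict (Icc 0 T)), ∀ i j, |(f t)⁻¹ i j| ≤ c) :
    MatLInfty T (fun t => (f t)⁻¹) := by
  intro i j
  refine memLp_top_of_bound ?_ c (hc.mono fun t ht => ht i j)
  have hm : AEMeasurable (fun t => (fun k l => f t k l : ι → ι → ℝ)) (volume.restrict (Icc 0 T)) :=
    aemeasurable_pi_lambda _ fun k => aemeasurable_pi_lambda _ fun l =>
      (hf k l).aestronglyMeasurable.aemeasurable
  have hof : Continuous (fun M : ι → ι → ℝ => Matrix.of M) :=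
    continuous_matrix fun k l => by simp only [Matrix.of_apply]; fun_prop
  have hdet' : Continuous (fun M : ι → ι → ℝ => (Matrix.of M).det) := hof.matrix_det
  have hadj' : Continuous (fun M : ι → ι → ℝ => (Matrix.of M).adjugate i j) :=
    hof.matrix_adjugate.matrix_elem i j
  have hdet := hdet'.measurable
  have hadj := hadj'.measurable
  have := ((hdet.inv.mul hadj).comp_aemeasurable hm).aestronglyMeasurable
  convert this using 2 with t
  simp [Matrix.inv_def, Ring.inverse_eq_inv']
  rfl

/-- The entrywise derivative of `M⁻¹` for a matrix function with essentially bounded derivative. -/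
theorem IsMatPrimitiveOn.inv {ι : Type*} [Fintype ι] [DecidableEq ι] {T : ℝ}
    {M M' : ℝ → Matrix ι ι ℝ} (hT : 0 ≤ T) (hM : IsMatPrimitiveOn 0 T M M')
    (hM' : MatLInfty T M') (hu : ∀ s ∈ Icc 0 T, IsUnit (M s)) :
    IsMatPrimitiveOn 0 T (fun s => (M s)⁻¹) (fun s => -((M s)⁻¹ * M' s * (M s)⁻¹)) := by
  have hdet (s) (hs : s ∈ Icc 0 T) : IsUnit (M s).det := (isUnit_iff_isUnit_det _).1 (hu s hs)
  have hMc := hM.continuousOn hT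
  have hinv : ContinuousOn (fun s => (M s)⁻¹) (Icc 0 T) := by
    simp only [Matrix.inv_def, Ring.inverse_eq_inv']
    exact ((continuous_id.matrix_det.comp_continuousOn hMc).inv₀ fun s hs => (hdet s hs).ne_zero).smul
      (continuous_id.matrix_adjugate.comp_continuousOn hMc)
  have hA : MatLInfty T (fun s => M' s * (M s)⁻¹) := hM'.mul (.of_continuousOn hinv)
  have hlin : IsMatPrimitiveOn 0 T M (fun s => M' s * (M s)⁻¹ * M s) :=
    hM.congr_ae hT <| (ae_restrict_iff' measurableSet_Icc).2 <| .of_forall fun s hs =>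
      (nonsing_inv_mul_cancel_right _ _ (hdet s hs)).symm
  obtain ⟨-, Z, hZ, hZ'⟩ := inv_of_linear hT hA hlin (hu 0 ⟨le_rfl, hT⟩)
  have h1 : IsMatPrimitiveOn 0 T Z (fun s => -((M s)⁻¹ * M' s * (M s)⁻¹)) :=
    hZ'.congr_ae hT <| (ae_restrict_iff' measurableSet_Icc).2 <| .of_forall fun s hs => by
      rw [hZ s hs, Matrix.mul_assoc]
  exact h1.congr hZ

namespace LQGame

variable {n m₁ m₂ : ℕ} {𝒢 : LQGame n m₁ m₂}

namespace Standing

theorem B_bdd (h : 𝒢.Standing) : MatLInfty 𝒢.T 𝒢.B := h.B₁_bdd.fromCols h.B₂_bdd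

theorem S_bdd (h : 𝒢.Standing) : MatLInfty 𝒢.T 𝒢.S := h.S₁_bdd.fromRows h.S₂_bdd

theorem R_bdd (h : 𝒢.Standing) : MatLInfty 𝒢.T 𝒢.R :=
  h.R₁₁_bdd.fromBlocks h.R₁₂_bdd h.R₂₁_bdd h.R₂₂_bdd

theorem R_symm (h : 𝒢.Standing) : ∀ᵐ t ∂(volume.restrict (Icc 0 𝒢.T)), (𝒢.R t).IsSymm := by
  filter_upwards [h.R₁₁_symm, h.R₂₂_symm, h.R₁₂_symm] with t h₁ h₂ h₃
  simp only [IsSymm, R, fromBlocks_transpose, ← h₃, transpose_transpose]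
  rw [h₁, h₂]

theorem R_inv (h : 𝒢.Standing) (hR₁₁ : MatStrictlyAbove 𝒢.T 𝒢.R₁₁ 0)
    (hR₂₂ : MatStrictlyAbove 𝒢.T 0 𝒢.R₂₂) :
    (∀ᵐ t ∂(volume.restrict (Icc 0 𝒢.T)), IsUnit (𝒢.R t)) ∧ MatLInfty 𝒢.T (fun t => (𝒢.R t)⁻¹) := by
  obtain ⟨α₁, hα₁, h₁⟩ := hR₁₁
  obtain ⟨α₂, hα₂, h₂⟩ := hR₂₂
  have key : ∀ᵐ t ∂(volume.restrict (Icc 0 𝒢.T)),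
      IsUnit (𝒢.R t) ∧ ∀ i j, |(𝒢.R t)⁻¹ i j| ≤ (min α₁ α₂)⁻¹ := by
    filter_upwards [h₁, h₂, h.R₁₂_symm] with t h₁ h₂ h₃
    refine isUnit_and_abs_inv_le_of_coercive (lt_min hα₁ hα₂) fun a b => ?_
    rw [R, ← h₃]
    refine indefinite_block_coercive ?_ ?_ a b
    · have := h₁.add (PosSemidef.one.smul (sub_nonneg.2 (min_le_left α₁ α₂)))
      convert this using 1
      simp [sub_smul]
    · have := h₂.add (PosSemidef.one.smul (sub_nonneg.2 (min_le_right α₁ α₂)))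
      convert this using 1
      simp [sub_smul]
  exact ⟨key.mono fun t ht => ht.1, h.R_bdd.inv (key.mono fun t ht => ht.2)⟩

theorem hamiltonian_bdd (h : 𝒢.Standing) (hR : MatLInfty 𝒢.T (fun t => (𝒢.R t)⁻¹)) :
    MatLInfty 𝒢.T 𝒢.hamiltonian :=
  ((h.A_bdd.sub ((h.B_bdd.mul hR).mul h.S_bdd)).fromBlocks
    ((h.B_bdd.mul hR).mul h.B_bdd.transpose).neg
    (h.Q_bdd.sub ((h.S_bdd.transpose.mul hR).mul h.S_bdd)).neg
    (h.A_bdd.sub ((h.B_bdd.mul hR).mul h.S_bdd)).transpose.neg)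

end Standing

end LQGame

namespace LQGame

variable {n m₁ m₂ : ℕ} {𝒢 : LQGame n m₁ m₂}

/-! ### The Riccati equation and the Hamiltonian system -/

/-- The right-hand side of the Riccati equation, solved for `Ṗ`. -/
noncomputable def riccatiRHS (𝒢 : LQGame n m₁ m₂) (s : ℝ) (p : Matrix (Fin n) (Fin n) ℝ) :
    Matrix (Fin n) (Fin n) ℝ :=
  -(p * 𝒢.A s + (𝒢.A s)ᵀ * p + 𝒢.Q s
    - (p * 𝒢.B s + (𝒢.S s)ᵀ) * (𝒢.R s)⁻¹ * ((𝒢.B s)ᵀ * p + 𝒢.S s))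

theorem isRiccatiSolution_iff (h : 𝒢.Standing) {P : ℝ → Matrix (Fin n) (Fin n) ℝ} :
    𝒢.IsRiccatiSolution P ↔ (∀ t ∈ Icc 0 𝒢.T, (P t).IsSymm) ∧
      IsMatPrimitiveOn 0 𝒢.T P (fun s => 𝒢.riccatiRHS s (P s)) ∧ P 𝒢.T = 𝒢.G := by
  rw [← IsMatPrimitiveOn.isMatODESolution_iff (F := 𝒢.riccatiRHS) h.T_pos.le]
  rfl

/-- The difference of two solutions solves a linear homogeneous equation. Symmetry of the solutions
is not used, so the lemma also compares a solution with its transpose. -/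
theorem riccati_unique (h : 𝒢.Standing) (hR : MatLInfty 𝒢.T (fun t => (𝒢.R t)⁻¹))
    {P P' : ℝ → Matrix (Fin n) (Fin n) ℝ}
    (hP : IsMatPrimitiveOn 0 𝒢.T P (fun s => 𝒢.riccatiRHS s (P s)))
    (hP' : IsMatPrimitiveOn 0 𝒢.T P' (fun s => 𝒢.riccatiRHS s (P' s)))
    (hT : P 𝒢.T = P' 𝒢.T) {s : ℝ} (hs : s ∈ Icc 0 𝒢.T) : P s = P' s := by
  have hT0 := h.T_pos.le
  have hPb : MatLInfty 𝒢.T P := .of_continuousOn (hP.continuousOn hT0)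
  have hPb' : MatLInfty 𝒢.T P' := .of_continuousOn (hP'.continuousOn hT0)
  have hα : MatLInfty 𝒢.T (fun s => 𝒢.B s * (𝒢.R s)⁻¹ * ((𝒢.B s)ᵀ * P s + 𝒢.S s) - 𝒢.A s) :=
    ((h.B_bdd.mul hR).mul ((h.B_bdd.transpose.mul hPb).add h.S_bdd)).sub h.A_bdd
  have hβ : MatLInfty 𝒢.T
      (fun s => (P' s * 𝒢.B s + (𝒢.S s)ᵀ) * (𝒢.R s)⁻¹ * (𝒢.B s)ᵀ - (𝒢.A s)ᵀ) :=
    (((((hPb'.mul h.B_bdd).add h.S_bdd.transpose)).mul hR).mul h.B_bdd.transpose).sub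
      h.A_bdd.transpose
  have hD := (hP.add hP'.neg).congr_ae (N' := fun s => (P s + -P' s) *
      (𝒢.B s * (𝒢.R s)⁻¹ * ((𝒢.B s)ᵀ * P s + 𝒢.S s) - 𝒢.A s) +
      ((P' s * 𝒢.B s + (𝒢.S s)ᵀ) * (𝒢.R s)⁻¹ * (𝒢.B s)ᵀ - (𝒢.A s)ᵀ) * (P s + -P' s)) hT0
    (.of_forall fun r => by
      simp only [riccatiRHS, Matrix.mul_add, Matrix.add_mul, Matrix.mul_sub, Matrix.sub_mul,
        Matrix.mul_assoc, Matrix.neg_mul, Matrix.mul_neg]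
      abel)
  have := eq_zero_of_sylvester hT0 hα hβ hD (by simp [hT]) hs
  rwa [← sub_eq_add_neg, sub_eq_zero] at this

theorem riccatiRHS_transpose {s : ℝ} (hQ : (𝒢.Q s).IsSymm) (hR : (𝒢.R s).IsSymm)
    (p : Matrix (Fin n) (Fin n) ℝ) : (𝒢.riccatiRHS s p)ᵀ = 𝒢.riccatiRHS s pᵀ := by
  have hQ' : (𝒢.Q s)ᵀ = 𝒢.Q s := hQ
  have hR' : (𝒢.R s)ᵀ = 𝒢.R s := hR
  simp only [riccatiRHS, transpose_neg, transpose_sub, transpose_add, transpose_mul,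
    transpose_transpose, transpose_nonsing_inv, hQ', hR', Matrix.mul_assoc]
  abel

/-- `Γ(t) = (G, -I) Ψ(T) Ψ(t)⁻¹ (I; 0)`, the companion of `Λ(t)`. -/
noncomputable def gam (𝒢 : LQGame n m₁ m₂) (Ψ : ℝ → Matrix (Fin n ⊕ Fin n) (Fin n ⊕ Fin n) ℝ)
    (t : ℝ) : Matrix (Fin n) (Fin n) ℝ :=
  fromCols 𝒢.G (-1 : Matrix (Fin n) (Fin n) ℝ) * (Ψ 𝒢.T * (Ψ t)⁻¹) *
    fromRows (1 : Matrix (Fin n) (Fin n) ℝ) (0 : Matrix (Fin n) (Fin n) ℝ)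

theorem IsFundamentalMatrix.isUnit (h : 𝒢.Standing) (hR : MatLInfty 𝒢.T (fun t => (𝒢.R t)⁻¹))
    {Ψ : ℝ → Matrix (Fin n ⊕ Fin n) (Fin n ⊕ Fin n) ℝ} (hΨ : 𝒢.IsFundamentalMatrix Ψ) {t : ℝ}
    (ht : t ∈ Icc 0 𝒢.T) : IsUnit (Ψ t) :=
  (inv_of_linear h.T_pos.le (h.hamiltonian_bdd hR)
    ((IsMatPrimitiveOn.isMatODESolution_iff h.T_pos.le).1 hΨ.1) hΨ.2).1 t ht

theorem exists_isFundamentalMatrix (h : 𝒢.Standing) (hR : MatLInfty 𝒢.T (fun t => (𝒢.R t)⁻¹)) :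
    ∃ Ψ, 𝒢.IsFundamentalMatrix Ψ := by
  obtain ⟨Ψ, hΨ, h0⟩ := exists_linear_solution h.T_pos.le (h.hamiltonian_bdd hR)
    (1 : Matrix (Fin n ⊕ Fin n) (Fin n ⊕ Fin n) ℝ)
  exact ⟨Ψ, (IsMatPrimitiveOn.isMatODESolution_iff h.T_pos.le).2 hΨ, by rw [h0]; exact isUnit_one⟩

theorem mul_fromRows_one_zero {ι : Type*} (W : Matrix ι (Fin n ⊕ Fin n) ℝ) :
    W * fromRows (1 : Matrix (Fin n) (Fin n) ℝ) (0 : Matrix (Fin n) (Fin n) ℝ) = W.toCols₁ := by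
  rw [← fromCols_toCols W, fromCols_mul_fromRows]
  simp

theorem mul_fromRows_zero_one {ι : Type*} (W : Matrix ι (Fin n ⊕ Fin n) ℝ) :
    W * fromRows (0 : Matrix (Fin n) (Fin n) ℝ) (1 : Matrix (Fin n) (Fin n) ℝ) = W.toCols₂ := by
  rw [← fromCols_toCols W, fromCols_mul_fromRows]
  simp

/-- The row `W = (G, -I) Ψ(T) Ψ⁻¹ = (Γ, Λ)` satisfies `Ẇ = -W H`; this gives the derivatives of
its two blocks. -/
theorem gam_Lam_deriv (h : 𝒢.Standing) (hR : MatLInfty 𝒢.T (fun t => (𝒢.R t)⁻¹))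
    {Ψ : ℝ → Matrix (Fin n ⊕ Fin n) (Fin n ⊕ Fin n) ℝ} (hΨ : 𝒢.IsFundamentalMatrix Ψ) :
    IsMatPrimitiveOn 0 𝒢.T (𝒢.gam Ψ) (fun s =>
      -(𝒢.gam Ψ s * (𝒢.A s - 𝒢.B s * (𝒢.R s)⁻¹ * 𝒢.S s) +
        𝒢.Lam Ψ s * (-(𝒢.Q s - (𝒢.S s)ᵀ * (𝒢.R s)⁻¹ * 𝒢.S s)))) ∧
    IsMatPrimitiveOn 0 𝒢.T (𝒢.Lam Ψ) (fun s =>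
      -(𝒢.gam Ψ s * (-(𝒢.B s * (𝒢.R s)⁻¹ * (𝒢.B s)ᵀ)) +
        𝒢.Lam Ψ s * (-(𝒢.A s - 𝒢.B s * (𝒢.R s)⁻¹ * 𝒢.S s)ᵀ))) := by
  have hT0 := h.T_pos.le
  obtain ⟨-, Z, hZ, hZ'⟩ := inv_of_linear hT0 (h.hamiltonian_bdd hR)
    ((IsMatPrimitiveOn.isMatODESolution_iff hT0).1 hΨ.1) hΨ.2
  set K := fromCols 𝒢.G (-1 : Matrix (Fin n) (Fin n) ℝ) * Ψ 𝒢.T with hK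
  have hW := (IsMatPrimitiveOn.const (a := 0) (b := 𝒢.T) K).mul hT0 hZ'
  have hW' : IsMatPrimitiveOn 0 𝒢.T (fun s => K * (Ψ s)⁻¹)
      (fun s => -(K * (Ψ s)⁻¹ * 𝒢.hamiltonian s)) := by
    have h1 := hW.congr_ae (N' := fun s => -(K * (Ψ s)⁻¹ * 𝒢.hamiltonian s)) hT0 <|
      (ae_restrict_iff' measurableSet_Icc).2 <| .of_forall fun s hs => by
        rw [hZ s hs]
        simp [Matrix.mul_assoc]
    exact h1.congr fun s hs => by rw [hZ s hs]
  have hg (s) : 𝒢.gam Ψ s = (K * (Ψ s)⁻¹).toCols₁ := by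
    rw [gam, mul_fromRows_one_zero, hK, Matrix.mul_assoc]
  have hl (s) : 𝒢.Lam Ψ s = (K * (Ψ s)⁻¹).toCols₂ := by
    rw [Lam, mul_fromRows_zero_one, hK, Matrix.mul_assoc]
  have hWH (s) : K * (Ψ s)⁻¹ * 𝒢.hamiltonian s =
      fromCols
        (𝒢.gam Ψ s * (𝒢.A s - 𝒢.B s * (𝒢.R s)⁻¹ * 𝒢.S s) +
          𝒢.Lam Ψ s * (-(𝒢.Q s - (𝒢.S s)ᵀ * (𝒢.R s)⁻¹ * 𝒢.S s)))
        (𝒢.gam Ψ s * (-(𝒢.B s * (𝒢.R s)⁻¹ * (𝒢.B s)ᵀ)) +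
          𝒢.Lam Ψ s * (-(𝒢.A s - 𝒢.B s * (𝒢.R s)⁻¹ * 𝒢.S s)ᵀ)) := by
    rw [← fromCols_toCols (K * (Ψ s)⁻¹), ← hg, ← hl, hamiltonian, fromCols_mul_fromBlocks]
  constructor
  · intro i j
    have := hW' i (Sum.inl j)
    simp only [hWH, Matrix.neg_apply, fromCols_apply_inl] at this
    simpa only [hg, toCols₁_apply, Matrix.neg_apply] using this
  · intro i j
    have := hW' i (Sum.inr j)
    simp only [hWH, Matrix.neg_apply, fromCols_apply_inr] at this
    simpa only [hl, toCols₂_apply, Matrix.neg_apply] using this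

theorem Lam_T (h : 𝒢.Standing) (hR : MatLInfty 𝒢.T (fun t => (𝒢.R t)⁻¹))
    {Ψ : ℝ → Matrix (Fin n ⊕ Fin n) (Fin n ⊕ Fin n) ℝ} (hΨ : 𝒢.IsFundamentalMatrix Ψ) :
    𝒢.Lam Ψ 𝒢.T = -1 := by
  have hu := (isUnit_iff_isUnit_det _).1 (hΨ.isUnit h hR ⟨h.T_pos.le, le_rfl⟩)
  rw [Lam, mul_nonsing_inv _ hu, Matrix.mul_one, fromCols_mul_fromRows]
  simp

theorem gam_T (h : 𝒢.Standing) (hR : MatLInfty 𝒢.T (fun t => (𝒢.R t)⁻¹))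
    {Ψ : ℝ → Matrix (Fin n ⊕ Fin n) (Fin n ⊕ Fin n) ℝ} (hΨ : 𝒢.IsFundamentalMatrix Ψ) :
    𝒢.gam Ψ 𝒢.T = 𝒢.G := by
  have hu := (isUnit_iff_isUnit_det _).1 (hΨ.isUnit h hR ⟨h.T_pos.le, le_rfl⟩)
  rw [gam, mul_nonsing_inv _ hu, Matrix.mul_one, fromCols_mul_fromRows]
  simp

/-- Wherever `Λ` stays nonsingular, `-Λ⁻¹ Γ` solves the Riccati equation. -/
theorem isRiccatiSolution_of_isUnit_Lam (h : 𝒢.Standing)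
    (hR : MatLInfty 𝒢.T (fun t => (𝒢.R t)⁻¹))
    {Ψ : ℝ → Matrix (Fin n ⊕ Fin n) (Fin n ⊕ Fin n) ℝ} (hΨ : 𝒢.IsFundamentalMatrix Ψ)
    (hΛ : ∀ t ∈ Icc 0 𝒢.T, IsUnit (𝒢.Lam Ψ t)) :
    𝒢.IsRiccatiSolution (fun t => -(𝒢.Lam Ψ t)⁻¹ * 𝒢.gam Ψ t) := by
  have hT0 := h.T_pos.le
  obtain ⟨hg, hl⟩ := gam_Lam_deriv h hR hΨ
  have hgb : MatLInfty 𝒢.T (𝒢.gam Ψ) := .of_continuousOn (hg.continuousOn hT0)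
  have hlb : MatLInfty 𝒢.T (𝒢.Lam Ψ) := .of_continuousOn (hl.continuousOn hT0)
  have hM : MatLInfty 𝒢.T (fun s => 𝒢.A s - 𝒢.B s * (𝒢.R s)⁻¹ * 𝒢.S s) :=
    h.A_bdd.sub ((h.B_bdd.mul hR).mul h.S_bdd)
  have hinv := hl.inv hT0 (((hgb.mul ((h.B_bdd.mul hR).mul h.B_bdd.transpose).neg).add
    (hlb.mul hM.transpose.neg)).neg) hΛ
  have hP : IsMatPrimitiveOn 0 𝒢.T (fun t => -(𝒢.Lam Ψ t)⁻¹ * 𝒢.gam Ψ t)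
      (fun s => 𝒢.riccatiRHS s (-(𝒢.Lam Ψ s)⁻¹ * 𝒢.gam Ψ s)) := by
    refine (hinv.neg.mul hT0 hg).congr_ae hT0 ?_
    filter_upwards [ae_restrict_mem measurableSet_Icc, h.R_symm] with s hs hRs
    have hu := (isUnit_iff_isUnit_det _).1 (hΛ s hs)
    have hRt : ((𝒢.R s)⁻¹)ᵀ = (𝒢.R s)⁻¹ := by rw [transpose_nonsing_inv, hRs]
    simp only [riccatiRHS, Matrix.mul_add, Matrix.add_mul, Matrix.mul_sub, Matrix.sub_mul,
      Matrix.mul_assoc, Matrix.neg_mul, Matrix.mul_neg, neg_add_rev, neg_neg, neg_sub,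
      transpose_sub, transpose_mul, hRt, nonsing_inv_mul_cancel_left _ _ hu]
    abel
  have hPT : -(𝒢.Lam Ψ 𝒢.T)⁻¹ * 𝒢.gam Ψ 𝒢.T = 𝒢.G := by
    rw [Lam_T h hR hΨ, gam_T h hR hΨ, inv_eq_left_inv (B := -1) (by simp)]
    simp
  refine (isRiccatiSolution_iff h).2 ⟨fun t ht => ?_, hP, hPT⟩
  refine (riccati_unique h hR hP (hP.transpose.congr_ae hT0 ?_) ?_ ht).symm
  · filter_upwards [h.Q_symm, h.R_symm] with s h1 h2
    exact riccatiRHS_transpose h1 h2 _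
  · rw [hPT]
    exact h.G_symm.symm

end LQGame

/-! ### The deterministic quadratic form -/

theorem memLp_mulVec {α ι κ : Type*} [Fintype κ] {_ : MeasurableSpace α}
    {ν : Measure α} {W : α → Matrix ι κ ℝ} {z : α → κ → ℝ}
    (hW : ∀ i j, MemLp (fun a => W a i j) ∞ ν) (hz : ∀ i, MemLp (fun a => z a i) 2 ν) (i : ι) :
    MemLp (fun a => (W a *ᵥ z a) i) 2 ν := by
  simp only [mulVec, dotProduct]
  exact memLp_finsetSum _ fun k _ => (hz k).mul (hW i k)

theorem integrable_mulVec_dotProduct {α ι : Type*} [Fintype ι] {_ : MeasurableSpace α}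
    {ν : Measure α} {W : α → Matrix ι ι ℝ} {z z' : α → ι → ℝ}
    (hW : ∀ i j, MemLp (fun a => W a i j) ∞ ν) (hz : ∀ i, MemLp (fun a => z a i) 2 ν)
    (hz' : ∀ i, MemLp (fun a => z' a i) 2 ν) :
    Integrable (fun a => (W a *ᵥ z a) ⬝ᵥ z' a) ν := by
  simp only [dotProduct]
  exact integrable_finsetSum _ fun i _ => (memLp_mulVec hW hz i).integrable_mul (hz' i)

theorem dotProduct_mulVec_comm_of_isSymm {ι : Type*} [Fintype ι] {M : Matrix ι ι ℝ}
    (hM : M.IsSymm) (v w : ι → ℝ) : (M *ᵥ v) ⬝ᵥ w = (M *ᵥ w) ⬝ᵥ v := by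
  rw [dotProduct_comm, dotProduct_mulVec, ← mulVec_transpose, hM]

namespace LQGame

variable {n m₁ m₂ : ℕ} {𝒢 : LQGame n m₁ m₂}

/-- The weight `(Q, Sᵀ; S, R)` of the running cost. -/
def weight (𝒢 : LQGame n m₁ m₂) (s : ℝ) :
    Matrix (Fin n ⊕ (Fin m₁ ⊕ Fin m₂)) (Fin n ⊕ (Fin m₁ ⊕ Fin m₂)) ℝ :=
  fromBlocks (𝒢.Q s) (𝒢.S s)ᵀ (𝒢.S s) (𝒢.R s)

theorem Standing.weight_bdd (h : 𝒢.Standing) : MatLInfty 𝒢.T 𝒢.weight :=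
  h.Q_bdd.fromBlocks h.S_bdd.transpose h.S_bdd h.R_bdd

theorem Standing.weight_symm (h : 𝒢.Standing) :
    ∀ᵐ t ∂(volume.restrict (Icc 0 𝒢.T)), (𝒢.weight t).IsSymm := by
  filter_upwards [h.Q_symm, h.R_symm] with t h₁ h₂
  have h₁' : (𝒢.Q t)ᵀ = 𝒢.Q t := h₁
  have h₂' : (𝒢.R t)ᵀ = 𝒢.R t := h₂
  rw [IsSymm, weight, fromBlocks_transpose, h₁', h₂', transpose_transpose]

/-- The pairs `(X, u)` of a square-integrable control (both players' controls in one vector) and a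
solution `X` of the state equation on `[t,T]`, with arbitrary initial value. -/
def admissible (𝒢 : LQGame n m₁ m₂) (t : ℝ) :
    Submodule ℝ ((ℝ → Fin n → ℝ) × (ℝ → Fin m₁ ⊕ Fin m₂ → ℝ)) where
  carrier := {p | (∀ k, MemLp (fun s => p.2 s k) 2 (volume.restrict (Icc t 𝒢.T))) ∧
    IsVecPrimitiveOn t 𝒢.T p.1 (fun s => 𝒢.A s *ᵥ p.1 s + 𝒢.B s *ᵥ p.2 s)}
  zero_mem' := ⟨fun _ => MemLp.zero, fun i => by simpa using IsPrimitiveOn.const 0⟩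
  add_mem' := by
    rintro p q ⟨hp, hp'⟩ ⟨hq, hq'⟩
    refine ⟨fun k => (hp k).add (hq k), ?_⟩
    convert hp'.add hq' using 2 with s
    · rfl
    · rename_i s
      change 𝒢.A s *ᵥ (p.1 s + q.1 s) + 𝒢.B s *ᵥ (p.2 s + q.2 s) = _
      rw [mulVec_add, mulVec_add]
      abel
  smul_mem' := by
    rintro c p ⟨hp, hp'⟩
    refine ⟨fun k => (hp k).const_mul c, fun i => ?_⟩
    convert (hp' i).const_mul c using 2 with s
    · rfl
    · rename_i s
      change (𝒢.A s *ᵥ (c • p.1 s) + 𝒢.B s *ᵥ (c • p.2 s)) i = _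
      simp only [mulVec_smul, Pi.add_apply, Pi.smul_apply, smul_eq_mul]
      ring

/-- The vector `(X(s), u(s))`. -/
def stack (p : (ℝ → Fin n → ℝ) × (ℝ → Fin m₁ ⊕ Fin m₂ → ℝ)) (s : ℝ) :
    Fin n ⊕ (Fin m₁ ⊕ Fin m₂) → ℝ :=
  Sum.elim (p.1 s) (p.2 s)

theorem restrict_Icc_le {t T : ℝ} (ht : 0 ≤ t) :
    volume.restrict (Icc t T) ≤ volume.restrict (Icc (0 : ℝ) T) :=
  Measure.restrict_mono_set volume (Icc_subset_Icc_left ht)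

theorem ae_Icc_of_ae_Icc {t T : ℝ} (ht : 0 ≤ t) {p : ℝ → Prop}
    (h : ∀ᵐ s ∂(volume.restrict (Icc 0 T)), p s) : ∀ᵐ s ∂(volume.restrict (Icc t T)), p s :=
  h.filter_mono (ae_mono (restrict_Icc_le ht))

theorem memLp_stack {t : ℝ} (ht : t ≤ 𝒢.T)
    {p : (ℝ → Fin n → ℝ) × (ℝ → Fin m₁ ⊕ Fin m₂ → ℝ)} (hp : p ∈ 𝒢.admissible t)
    (k : Fin n ⊕ (Fin m₁ ⊕ Fin m₂)) :
    MemLp (fun s => stack p s k) 2 (volume.restrict (Icc t 𝒢.T)) := by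
  rcases k with i | k
  · exact memLp_of_continuousOn_Icc ((hp.2 i).continuousOn ht) 2
  · exact hp.1 k

theorem intervalIntegrable_cost (h : 𝒢.Standing) {t : ℝ} (ht : t ∈ Icc 0 𝒢.T)
    {p q : (ℝ → Fin n → ℝ) × (ℝ → Fin m₁ ⊕ Fin m₂ → ℝ)} (hp : p ∈ 𝒢.admissible t)
    (hq : q ∈ 𝒢.admissible t) :
    IntervalIntegrable (fun s => (𝒢.weight s *ᵥ stack p s) ⬝ᵥ stack q s) volume t 𝒢.T := by
  rw [intervalIntegrable_iff_integrableOn_Icc_of_le ht.2]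
  exact integrable_mulVec_dotProduct
    (fun i j => (h.weight_bdd i j).mono_measure (restrict_Icc_le ht.1))
    (memLp_stack ht.2 hp) (memLp_stack ht.2 hq)

/-- The cost `⟨G X(T), X'(T)⟩ + ∫ ⟨(Q, Sᵀ; S, R)(X, u), (X', u')⟩` as a bilinear form on
admissible pairs. -/
noncomputable def costForm (h : 𝒢.Standing) {t : ℝ} (ht : t ∈ Icc 0 𝒢.T) :
    LinearMap.BilinForm ℝ (𝒢.admissible t) :=
  LinearMap.mk₂ ℝ
    (fun p q => (𝒢.G *ᵥ p.1.1 𝒢.T) ⬝ᵥ q.1.1 𝒢.T +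
      ∫ s in t..𝒢.T, (𝒢.weight s *ᵥ stack p.1 s) ⬝ᵥ stack q.1 s)
    (by
      intro p p' q
      have hs (s) : stack (p + p').1 s = stack p.1 s + stack p'.1 s := by
        ext (i | i) <;> rfl
      simp only [hs, mulVec_add, add_dotProduct]
      rw [intervalIntegral.integral_add (intervalIntegrable_cost h ht p.2 q.2)
        (intervalIntegrable_cost h ht p'.2 q.2)]
      simp only [Submodule.coe_add, Prod.fst_add, Pi.add_apply, mulVec_add, add_dotProduct]
      ring)
    (by
      intro c p q
      have hs (s) : stack (c • p).1 s = c • stack p.1 s := by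
        ext (i | i) <;> rfl
      simp only [hs, mulVec_smul, smul_dotProduct, smul_eq_mul]
      rw [intervalIntegral.integral_const_mul]
      simp only [Submodule.coe_smul, Prod.smul_fst, Pi.smul_apply, mulVec_smul, smul_dotProduct,
        smul_eq_mul]
      ring)
    (by
      intro p q q'
      have hs (s) : stack (q + q').1 s = stack q.1 s + stack q'.1 s := by
        ext (i | i) <;> rfl
      simp only [hs, dotProduct_add]
      rw [intervalIntegral.integral_add (intervalIntegrable_cost h ht p.2 q.2)
        (intervalIntegrable_cost h ht p.2 q'.2)]
      simp only [Submodule.coe_add, Prod.fst_add, Pi.add_apply, dotProduct_add]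
      ring)
    (by
      intro c p q
      have hs (s) : stack (c • q).1 s = c • stack q.1 s := by
        ext (i | i) <;> rfl
      simp only [hs, dotProduct_smul, smul_eq_mul]
      rw [intervalIntegral.integral_const_mul]
      simp only [Submodule.coe_smul, Prod.smul_fst, Pi.smul_apply, dotProduct_smul, smul_eq_mul]
      ring)

theorem costForm_apply (h : 𝒢.Standing) {t : ℝ} (ht : t ∈ Icc 0 𝒢.T) (p q : 𝒢.admissible t) :
    costForm h ht p q = (𝒢.G *ᵥ p.1.1 𝒢.T) ⬝ᵥ q.1.1 𝒢.T +
      ∫ s in t..𝒢.T, (𝒢.weight s *ᵥ stack p.1 s) ⬝ᵥ stack q.1 s :=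
  rfl

theorem costForm_comm (h : 𝒢.Standing) {t : ℝ} (ht : t ∈ Icc 0 𝒢.T) (p q : 𝒢.admissible t) :
    costForm h ht p q = costForm h ht q p := by
  rw [costForm_apply, costForm_apply, dotProduct_mulVec_comm_of_isSymm h.G_symm]
  congr 1
  refine intervalIntegral.integral_congr_ae ?_
  filter_upwards [(ae_restrict_iff' measurableSet_Icc).1 h.weight_symm] with s hs hst
  rw [uIoc_of_le ht.2] at hst
  exact dotProduct_mulVec_comm_of_isSymm (hs ⟨ht.1.trans hst.1.le, hst.2⟩) _ _

/-- Duality: if `(X, u)` satisfies the stationarity condition with adjoint state `Y`, its pairing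
with any admissible `(X', u')` reduces to the boundary term `⟨Y(t), X'(t)⟩`. -/
theorem costForm_eq_of_stationary (h : 𝒢.Standing) {t : ℝ} (ht : t ∈ Icc 0 𝒢.T)
    (p q : 𝒢.admissible t) {Y : ℝ → Fin n → ℝ}
    (hY : IsVecPrimitiveOn t 𝒢.T Y
      (fun s => -((𝒢.A s)ᵀ *ᵥ Y s + 𝒢.Q s *ᵥ p.1.1 s + (𝒢.S s)ᵀ *ᵥ p.1.2 s)))
    (hstat : ∀ᵐ s ∂(volume.restrict (Icc t 𝒢.T)),
      (𝒢.B s)ᵀ *ᵥ Y s + 𝒢.S s *ᵥ p.1.1 s + 𝒢.R s *ᵥ p.1.2 s = 0)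
    (hYT : Y 𝒢.T = 𝒢.G *ᵥ p.1.1 𝒢.T) :
    costForm h ht p q = Y t ⬝ᵥ q.1.1 t := by
  have hprim := (hY.dotProduct ht.2 q.2.2).congr_ae
    (γ := fun s => -((𝒢.weight s *ᵥ stack p.1 s) ⬝ᵥ stack q.1 s)) ht.2 (by
      filter_upwards [hstat] with s hs
      have hRu : 𝒢.S s *ᵥ p.1.1 s + 𝒢.R s *ᵥ p.1.2 s = -((𝒢.B s)ᵀ *ᵥ Y s) := by
        rw [eq_neg_iff_add_eq_zero, ← hs]
        abel
      rw [stack, stack, weight, fromBlocks_mulVec, sumElim_dotProduct_sumElim]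
      simp only [Sum.elim_comp_inl, Sum.elim_comp_inr]
      rw [hRu]
      simp only [neg_dotProduct, add_dotProduct, dotProduct_add]
      rw [mulVec_transpose (𝒢.A s), mulVec_transpose (𝒢.B s), ← dotProduct_mulVec,
        ← dotProduct_mulVec]
      ring)
  have := hprim.2 𝒢.T ⟨ht.2, le_rfl⟩
  beta_reduce at this
  rw [intervalIntegral.integral_neg, hYT] at this
  rw [costForm_apply]
  linarith

/-! ### The state equation -/

/-- A fundamental matrix of `Ẋ = A X` that equals the identity at time `0`. -/
theorem Standing.exists_transition (h : 𝒢.Standing) :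
    ∃ Φ Z : ℝ → Matrix (Fin n) (Fin n) ℝ,
      IsMatPrimitiveOn 0 𝒢.T Φ (fun s => 𝒢.A s * Φ s) ∧
      IsMatPrimitiveOn 0 𝒢.T Z (fun s => -(Z s * 𝒢.A s)) ∧
      ∀ s ∈ Icc 0 𝒢.T, Z s * Φ s = 1 ∧ Φ s * Z s = 1 := by
  obtain ⟨Φ, hΦ, h0⟩ := exists_linear_solution h.T_pos.le h.A_bdd (1 : Matrix (Fin n) (Fin n) ℝ)
  obtain ⟨hu, Z, hZ, hZ'⟩ := inv_of_linear h.T_pos.le h.A_bdd hΦ (by rw [h0]; exact isUnit_one)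
  refine ⟨Φ, Z, hΦ, hZ', fun s hs => ?_⟩
  have := (isUnit_iff_isUnit_det _).1 (hu s hs)
  rw [hZ s hs]
  exact ⟨nonsing_inv_mul _ this, mul_nonsing_inv _ this⟩

/-- The variation-of-constants formula, for a transition matrix `Φ` with inverse `Z`. -/
noncomputable def variationFormula (𝒢 : LQGame n m₁ m₂) (Φ Z : ℝ → Matrix (Fin n) (Fin n) ℝ)
    (t : ℝ) (x : Fin n → ℝ) (u : ℝ → Fin m₁ ⊕ Fin m₂ → ℝ) (s : ℝ) : Fin n → ℝ :=
  Φ s *ᵥ (Z t *ᵥ x + fun i => ∫ r in t..s, ((Z r * 𝒢.B r) *ᵥ u r) i)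

theorem eq_variationFormula {Φ Z : ℝ → Matrix (Fin n) (Fin n) ℝ}
    (hZ : IsMatPrimitiveOn 0 𝒢.T Z (fun s => -(Z s * 𝒢.A s)))
    (hZΦ : ∀ s ∈ Icc 0 𝒢.T, Z s * Φ s = 1 ∧ Φ s * Z s = 1) {t : ℝ} (ht : t ∈ Icc 0 𝒢.T)
    {X : ℝ → Fin n → ℝ} {u : ℝ → Fin m₁ ⊕ Fin m₂ → ℝ}
    (hX : IsVecPrimitiveOn t 𝒢.T X (fun s => 𝒢.A s *ᵥ X s + 𝒢.B s *ᵥ u s)) {s : ℝ}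
    (hs : s ∈ Icc t 𝒢.T) : X s = 𝒢.variationFormula Φ Z t (X t) u s := by
  have h1 := (IsVecPrimitiveOn.mulVec ht.2 (hZ.mono ht) hX).congr_ae
    (z' := fun s => (Z s * 𝒢.B s) *ᵥ u s) ht.2 (.of_forall fun r => by
      simp only [neg_mulVec, mulVec_add, mulVec_mulVec]
      abel)
  have h2 : Z t *ᵥ X t + (fun i => ∫ r in t..s, ((Z r * 𝒢.B r) *ᵥ u r) i) = Z s *ᵥ X s := by
    ext i
    exact ((h1 i).2 s hs).symm
  rw [variationFormula, h2, mulVec_mulVec, (hZΦ s ⟨ht.1.trans hs.1, hs.2⟩).2, one_mulVec]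

theorem exists_admissible (h : 𝒢.Standing) {t : ℝ} (ht : t ∈ Icc 0 𝒢.T) (x : Fin n → ℝ)
    {u : ℝ → Fin m₁ ⊕ Fin m₂ → ℝ}
    (hu : ∀ k, MemLp (fun s => u s k) 2 (volume.restrict (Icc t 𝒢.T))) :
    ∃ p : 𝒢.admissible t, p.1.1 t = x ∧ p.1.2 = u := by
  obtain ⟨Φ, Z, hΦ, hZ, hZΦ⟩ := h.exists_transition
  have hZB : MatLInfty 𝒢.T (fun s => Z s * 𝒢.B s) :=
    (MatLInfty.of_continuousOn (hZ.continuousOn h.T_pos.le)).mul h.B_bdd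
  have hint (i) : IntervalIntegrable (fun r => ((Z r * 𝒢.B r) *ᵥ u r) i) volume t 𝒢.T := by
    rw [intervalIntegrable_iff_integrableOn_Icc_of_le ht.2]
    exact (memLp_mulVec (fun i k => (hZB i k).mono_measure (restrict_Icc_le ht.1)) hu i).integrable
      one_le_two
  let y (s : ℝ) : Fin n → ℝ := Z t *ᵥ x + fun i => ∫ r in t..s, ((Z r * 𝒢.B r) *ᵥ u r) i
  have hy : IsVecPrimitiveOn t 𝒢.T y (fun s => (Z s * 𝒢.B s) *ᵥ u s) := by
    refine fun i => ⟨hint i, fun s _ => ?_⟩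
    simp [y]
  have hX := (IsVecPrimitiveOn.mulVec ht.2 (hΦ.mono ht) hy).congr_ae
    (z' := fun s => 𝒢.A s *ᵥ (Φ s *ᵥ y s) + 𝒢.B s *ᵥ u s) ht.2 (by
      filter_upwards [ae_restrict_mem measurableSet_Icc] with s hs
      rw [mulVec_mulVec, mulVec_mulVec, ← Matrix.mul_assoc,
        (hZΦ s ⟨ht.1.trans hs.1, hs.2⟩).2, Matrix.one_mul])
  refine ⟨⟨(fun s => Φ s *ᵥ y s, u), hu, hX⟩, ?_, rfl⟩
  have hy0 : y t = Z t *ᵥ x := by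
    ext i
    simp [y]
  simp only [hy0, mulVec_mulVec, (hZΦ t ht).2, one_mulVec]

theorem admissible_unique (h : 𝒢.Standing) {t : ℝ} (ht : t ∈ Icc 0 𝒢.T)
    {X X' : ℝ → Fin n → ℝ} {u : ℝ → Fin m₁ ⊕ Fin m₂ → ℝ}
    (hX : IsVecPrimitiveOn t 𝒢.T X (fun s => 𝒢.A s *ᵥ X s + 𝒢.B s *ᵥ u s))
    (hX' : IsVecPrimitiveOn t 𝒢.T X' (fun s => 𝒢.A s *ᵥ X' s + 𝒢.B s *ᵥ u s))
    (h0 : X t = X' t) {s : ℝ} (hs : s ∈ Icc t 𝒢.T) : X s = X' s := by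
  obtain ⟨Φ, Z, -, hZ, hZΦ⟩ := h.exists_transition
  rw [eq_variationFormula hZ hZΦ ht hX hs, eq_variationFormula hZ hZΦ ht hX' hs, h0]

/-- `IsTrajectory`, with the two controls stacked, is the entrywise notion of primitive. -/
theorem isTrajectory_iff {t : ℝ} (ht : t ∈ Icc 0 𝒢.T) {x : Fin n → ℝ} {v₁ : ℝ → Fin m₁ → ℝ}
    {v₂ : ℝ → Fin m₂ → ℝ} {X : ℝ → Fin n → ℝ} :
    𝒢.IsTrajectory t x v₁ v₂ X ↔ X t = x ∧ IsVecPrimitiveOn t 𝒢.T X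
      (fun s => 𝒢.A s *ᵥ X s + 𝒢.B s *ᵥ Sum.elim (v₁ s) (v₂ s)) := by
  have hB (s) : 𝒢.A s *ᵥ X s + 𝒢.B₁ s *ᵥ v₁ s + 𝒢.B₂ s *ᵥ v₂ s =
      𝒢.A s *ᵥ X s + 𝒢.B s *ᵥ Sum.elim (v₁ s) (v₂ s) := by
    rw [B, fromCols_mulVec_sumElim, add_assoc]
  simp only [IsTrajectory, hB]
  set g := fun s => 𝒢.A s *ᵥ X s + 𝒢.B s *ᵥ Sum.elim (v₁ s) (v₂ s) with hg
  have happ {s : ℝ} (hi : IntervalIntegrable g volume t s) (i) :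
      (∫ r in t..s, g r) i = ∫ r in t..s, g r i :=
    ((ContinuousLinearMap.proj (R := ℝ) (φ := fun _ : Fin n => ℝ) i).intervalIntegral_comp_comm
      hi).symm
  have hsub {s : ℝ} (hs : s ∈ Icc t 𝒢.T) (hi : IntervalIntegrable g volume t 𝒢.T) :
      IntervalIntegrable g volume t s := by
    refine hi.mono_set ?_
    rw [uIcc_of_le hs.1, uIcc_of_le ht.2]
    exact Icc_subset_Icc_right hs.2
  constructor
  · rintro ⟨-, hi, hX⟩
    have h0 : X t = x := by simpa using hX t ⟨le_rfl, ht.2⟩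
    refine ⟨h0, fun i => ⟨?_, fun s hs => ?_⟩⟩
    · rw [intervalIntegrable_iff_integrableOn_Icc_of_le ht.2] at hi ⊢
      exact Integrable.eval hi i
    · have := congrFun (hX s hs) i
      rwa [Pi.add_apply, happ (hsub hs hi), ← h0] at this
  · rintro ⟨h0, hX⟩
    have hi : IntervalIntegrable g volume t 𝒢.T := by
      rw [intervalIntegrable_iff_integrableOn_Icc_of_le ht.2]
      exact Integrable.of_eval fun i =>
        (intervalIntegrable_iff_integrableOn_Icc_of_le ht.2).1 (hX i).1
    refine ⟨hX.continuousOn ht.2, hi, fun s hs => ?_⟩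
    ext i
    rw [Pi.add_apply, happ (hsub hs hi), ← h0]
    exact (hX i).2 s hs

/-- For square-integrable inputs the trajectory of the game is the state component of the
admissible pair. -/
theorem trajectory_eq (h : 𝒢.Standing) {t : ℝ} (ht : t ∈ Icc 0 𝒢.T) {x : Fin n → ℝ}
    {v₁ : ℝ → Fin m₁ → ℝ} {v₂ : ℝ → Fin m₂ → ℝ} (p : 𝒢.admissible t) (hx : p.1.1 t = x)
    (hu : p.1.2 = fun s => Sum.elim (v₁ s) (v₂ s)) {s : ℝ} (hs : s ∈ Icc t 𝒢.T) :
    𝒢.trajectory t x v₁ v₂ s = p.1.1 s := by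
  have hp : IsVecPrimitiveOn t 𝒢.T p.1.1
      (fun s => 𝒢.A s *ᵥ p.1.1 s + 𝒢.B s *ᵥ Sum.elim (v₁ s) (v₂ s)) := by
    have := p.2.2
    rwa [hu] at this
  have hex : ∃ X, 𝒢.IsTrajectory t x v₁ v₂ X := ⟨p.1.1, (isTrajectory_iff ht).2 ⟨hx, hp⟩⟩
  rw [trajectory, dif_pos hex]
  obtain ⟨h0, hX⟩ := (isTrajectory_iff ht).1 hex.choose_spec
  exact admissible_unique h ht hX hp (h0.trans hx.symm) hs

/-- The pathwise cost of the game is the diagonal of `costForm`. -/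
theorem pathwise_cost_eq (h : 𝒢.Standing) {t : ℝ} (ht : t ∈ Icc 0 𝒢.T) {x : Fin n → ℝ}
    {v₁ : ℝ → Fin m₁ → ℝ} {v₂ : ℝ → Fin m₂ → ℝ} (p : 𝒢.admissible t) (hx : p.1.1 t = x)
    (hu : p.1.2 = fun s => Sum.elim (v₁ s) (v₂ s)) :
    (𝒢.G *ᵥ 𝒢.trajectory t x v₁ v₂ 𝒢.T) ⬝ᵥ 𝒢.trajectory t x v₁ v₂ 𝒢.T +
      ∫ s in t..𝒢.T, 𝒢.runningCost s (𝒢.trajectory t x v₁ v₂ s) (v₁ s) (v₂ s) =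
    costForm h ht p p := by
  rw [costForm_apply, trajectory_eq h ht p hx hu ⟨ht.2, le_rfl⟩]
  congr 1
  refine intervalIntegral.integral_congr fun s hs => ?_
  rw [uIcc_of_le ht.2] at hs
  rw [trajectory_eq h ht p hx hu hs, stack, hu]
  rfl

end LQGame

/-! ### Degenerate directions of a convex-concave form -/

theorem nonneg_and_eq_zero_of_quadratic_bounded_below {a β γ c : ℝ}
    (h : ∀ l : ℝ, c ≤ l ^ 2 * a + 2 * l * β + γ) : 0 ≤ a ∧ (a = 0 → β = 0) := by
  constructor
  · -- At `l` and `-l` the linear terms cancel; `l = (|γ - c| + 1) / |a| + 1` is large enough.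
    by_contra! ha
    set l := (|γ - c| + 1) / (-a) + 1 with hl
    have ha' : 0 < -a := by linarith
    have hl1 : 1 ≤ l := by
      rw [hl, le_add_iff_nonneg_left]
      positivity
    have hla : |γ - c| + 1 ≤ l * (-a) := by
      rw [hl, add_mul, div_mul_cancel₀ _ ha'.ne']
      linarith
    have h1 := h l
    have h2 := h (-l)
    have h3 : l * (-a) ≤ l ^ 2 * (-a) :=
      mul_le_mul_of_nonneg_right (by nlinarith) ha'.le
    have := le_abs_self (γ - c)
    nlinarith
  · rintro rfl
    by_contra hβ
    have := h ((c - γ - 1) / (2 * β))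
    have h2 : 2 * ((c - γ - 1) / (2 * β)) * β = c - γ - 1 := by field_simp
    linarith

/-- If a symmetric form is nonnegative on `U₁` and nonpositive on `U₂`, and `p₁ + p₂` is orthogonal
to both subspaces, then so are `p₁` and `p₂` separately. -/
theorem orthogonal_of_add_orthogonal {V : Type*} [AddCommGroup V] [Module ℝ V]
    {b : LinearMap.BilinForm ℝ V} (hb : ∀ p q, b p q = b q p) {U₁ U₂ : Submodule ℝ V}
    (h₁ : ∀ p ∈ U₁, 0 ≤ b p p) (h₂ : ∀ p ∈ U₂, b p p ≤ 0) {p₁ p₂ : V} (hp₁ : p₁ ∈ U₁)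
    (hp₂ : p₂ ∈ U₂) (ho₁ : ∀ q ∈ U₁, b (p₁ + p₂) q = 0) (ho₂ : ∀ q ∈ U₂, b (p₁ + p₂) q = 0) :
    (b p₁ p₁ = 0 ∧ ∀ q ∈ U₂, b p₁ q = 0) ∧ (b p₂ p₂ = 0 ∧ ∀ q ∈ U₁, b p₂ q = 0) := by
  have e₁ := ho₁ p₁ hp₁
  have e₂ := ho₂ p₂ hp₂
  simp only [map_add, LinearMap.add_apply] at e₁ e₂
  rw [hb p₂ p₁] at e₁
  have s₁ := h₁ p₁ hp₁
  have s₂ := h₂ p₂ hp₂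
  have z₁ : b p₁ p₁ = 0 := by linarith
  have z₂ : b p₂ p₂ = 0 := by linarith
  refine ⟨⟨z₁, fun q hq => ?_⟩, z₂, fun q hq => ?_⟩
  · have hz : -b p₂ q = 0 := by
      refine (nonneg_and_eq_zero_of_quadratic_bounded_below (c := 0) (γ := -b q q)
        (a := 0) fun l => ?_).2 rfl
      have := h₂ (q + l • p₂) (U₂.add_mem hq (U₂.smul_mem l hp₂))
      simp only [map_add, LinearMap.add_apply, map_smul, LinearMap.smul_apply, smul_eq_mul,
        z₂, hb q p₂] at this
      linarith
    have := ho₂ q hq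
    simp only [map_add, LinearMap.add_apply] at this
    linarith
  · have hz : b p₁ q = 0 := by
      refine (nonneg_and_eq_zero_of_quadratic_bounded_below (c := 0) (γ := b q q)
        (a := 0) fun l => ?_).2 rfl
      have := h₁ (q + l • p₁) (U₁.add_mem hq (U₁.smul_mem l hp₁))
      simp only [map_add, LinearMap.add_apply, map_smul, LinearMap.smul_apply, smul_eq_mul,
        z₁, hb q p₁] at this
      linarith
    have := ho₁ q hq
    simp only [map_add, LinearMap.add_apply] at this
    linarith

/-! ### Stationary pairs and the matrix `Λ` -/

namespace LQGame

variable {n m₁ m₂ : ℕ} {𝒢 : LQGame n m₁ m₂}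

/-- Admissible pairs that start at `0` and in which only the first player acts. -/
def onlyFirst (𝒢 : LQGame n m₁ m₂) (t : ℝ) : Submodule ℝ (𝒢.admissible t) where
  carrier := {p | p.1.1 t = 0 ∧ ∀ s j, p.1.2 s (Sum.inr j) = 0}
  zero_mem' := ⟨rfl, fun _ _ => rfl⟩
  add_mem' := by
    rintro p q ⟨hp, hp'⟩ ⟨hq, hq'⟩
    refine ⟨?_, fun s j => ?_⟩
    · simp [hp, hq]
    · simp [hp', hq']
  smul_mem' := by
    rintro c p ⟨hp, hp'⟩
    refine ⟨?_, fun s j => ?_⟩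
    · simp [hp]
    · simp [hp']

/-- Admissible pairs that start at `0` and in which only the second player acts. -/
def onlySecond (𝒢 : LQGame n m₁ m₂) (t : ℝ) : Submodule ℝ (𝒢.admissible t) where
  carrier := {p | p.1.1 t = 0 ∧ ∀ s j, p.1.2 s (Sum.inl j) = 0}
  zero_mem' := ⟨rfl, fun _ _ => rfl⟩
  add_mem' := by
    rintro p q ⟨hp, hp'⟩ ⟨hq, hq'⟩
    refine ⟨?_, fun s j => ?_⟩
    · simp [hp, hq]
    · simp [hp', hq']
  smul_mem' := by
    rintro c p ⟨hp, hp'⟩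
    refine ⟨?_, fun s j => ?_⟩
    · simp [hp]
    · simp [hp']

/-- If `Λ(t) η = 0`, the Hamiltonian system has a solution with `X(t) = 0`, `Y(t) = η` and
`Y(T) = G X(T)`, so the quadratic form has a stationary admissible pair with initial adjoint
state `η`. -/
theorem exists_stationary_of_Lam_mulVec_eq_zero (h : 𝒢.Standing)
    (hRu : ∀ᵐ t ∂(volume.restrict (Icc 0 𝒢.T)), IsUnit (𝒢.R t))
    (hR : MatLInfty 𝒢.T (fun t => (𝒢.R t)⁻¹))
    {Ψ : ℝ → Matrix (Fin n ⊕ Fin n) (Fin n ⊕ Fin n) ℝ} (hΨ : 𝒢.IsFundamentalMatrix Ψ)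
    {t : ℝ} (ht : t ∈ Icc 0 𝒢.T) {η : Fin n → ℝ} (hη : 𝒢.Lam Ψ t *ᵥ η = 0) :
    ∃ p : 𝒢.admissible t, p.1.1 t = 0 ∧ ∀ q : 𝒢.admissible t,
      costForm h ht p q = η ⬝ᵥ q.1.1 t := by
  have hT0 := h.T_pos.le
  set c := (Ψ t)⁻¹ *ᵥ Sum.elim (0 : Fin n → ℝ) η with hc
  have hΞ : IsVecPrimitiveOn t 𝒢.T (fun s => Ψ s *ᵥ c) (fun s => 𝒢.hamiltonian s *ᵥ (Ψ s *ᵥ c)) := by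
    have h1 := ((IsMatPrimitiveOn.isMatODESolution_iff hT0).1 hΨ.1).mono ht
    have h2 : IsVecPrimitiveOn t 𝒢.T (fun _ => c) (fun _ => 0) := fun i => IsPrimitiveOn.const _
    convert IsVecPrimitiveOn.mulVec ht.2 h1 h2 using 2 with s
    simp
  set X : ℝ → Fin n → ℝ := fun s => (Ψ s *ᵥ c) ∘ Sum.inl with hX
  set Y : ℝ → Fin n → ℝ := fun s => (Ψ s *ᵥ c) ∘ Sum.inr with hY
  have hXY (s) : 𝒢.hamiltonian s *ᵥ (Ψ s *ᵥ c) = Sum.elim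
      ((𝒢.A s - 𝒢.B s * (𝒢.R s)⁻¹ * 𝒢.S s) *ᵥ X s + (-(𝒢.B s * (𝒢.R s)⁻¹ * (𝒢.B s)ᵀ)) *ᵥ Y s)
      ((-(𝒢.Q s - (𝒢.S s)ᵀ * (𝒢.R s)⁻¹ * 𝒢.S s)) *ᵥ X s +
        (-(𝒢.A s - 𝒢.B s * (𝒢.R s)⁻¹ * 𝒢.S s)ᵀ) *ᵥ Y s) := by
    rw [hamiltonian, fromBlocks_mulVec]
  have hX' : IsVecPrimitiveOn t 𝒢.T X (fun s => (𝒢.A s - 𝒢.B s * (𝒢.R s)⁻¹ * 𝒢.S s) *ᵥ X s +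
      (-(𝒢.B s * (𝒢.R s)⁻¹ * (𝒢.B s)ᵀ)) *ᵥ Y s) := by
    intro i
    have := hΞ (Sum.inl i)
    simp only [hXY, Sum.elim_inl] at this
    exact this
  have hY' : IsVecPrimitiveOn t 𝒢.T Y (fun s =>
      (-(𝒢.Q s - (𝒢.S s)ᵀ * (𝒢.R s)⁻¹ * 𝒢.S s)) *ᵥ X s +
        (-(𝒢.A s - 𝒢.B s * (𝒢.R s)⁻¹ * 𝒢.S s)ᵀ) *ᵥ Y s) := by
    intro i
    have := hΞ (Sum.inr i)
    simp only [hXY, Sum.elim_inr] at this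
    exact this
  set u : ℝ → Fin m₁ ⊕ Fin m₂ → ℝ :=
    fun s => (-((𝒢.R s)⁻¹ * (𝒢.B s)ᵀ)) *ᵥ Y s + (-((𝒢.R s)⁻¹ * 𝒢.S s)) *ᵥ X s with hu
  have hu2 (k) : MemLp (fun s => u s k) 2 (volume.restrict (Icc t 𝒢.T)) :=
    (memLp_mulVec (fun i j => ((hR.mul h.B_bdd.transpose).neg i j).mono_measure
        (restrict_Icc_le ht.1)) (fun i => memLp_of_continuousOn_Icc ((hY' i).continuousOn ht.2) _) k).add
      (memLp_mulVec (fun i j => ((hR.mul h.S_bdd).neg i j).mono_measure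
        (restrict_Icc_le ht.1)) (fun i => memLp_of_continuousOn_Icc ((hX' i).continuousOn ht.2) _) k)
  have hXu : IsVecPrimitiveOn t 𝒢.T X (fun s => 𝒢.A s *ᵥ X s + 𝒢.B s *ᵥ u s) :=
    hX'.congr_ae ht.2 (.of_forall fun s => by
      simp only [hu, sub_mulVec, neg_mulVec, mulVec_add, mulVec_neg, mulVec_mulVec,
        Matrix.mul_assoc]
      abel)
  have hΨt : Ψ t *ᵥ c = Sum.elim (0 : Fin n → ℝ) η := by
    rw [hc, mulVec_mulVec,
      mul_nonsing_inv _ ((isUnit_iff_isUnit_det _).1 (hΨ.isUnit h hR ht)), one_mulVec]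
  have hX0 : X t = 0 := by rw [hX]; simp only [hΨt]; rfl
  have hY0 : Y t = η := by rw [hY]; simp only [hΨt]; rfl
  refine ⟨⟨(X, u), hu2, hXu⟩, hX0, fun q => ?_⟩
  rw [costForm_eq_of_stationary h ht _ q (Y := Y), hY0]
  · refine hY'.congr_ae ht.2 ?_
    filter_upwards [ae_Icc_of_ae_Icc ht.1 h.R_symm] with s hs
    have hRt : ((𝒢.R s)⁻¹)ᵀ = (𝒢.R s)⁻¹ := by rw [transpose_nonsing_inv, hs]
    simp only [hu, sub_mulVec, neg_mulVec, mulVec_add, mulVec_neg, mulVec_mulVec,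
      Matrix.mul_assoc, transpose_sub, transpose_mul, hRt]
    abel
  · filter_upwards [ae_Icc_of_ae_Icc ht.1 hRu] with s hs
    have hs' := (isUnit_iff_isUnit_det _).1 hs
    simp only [hu, neg_mulVec, mulVec_add, mulVec_neg, mulVec_mulVec,
      mul_nonsing_inv_cancel_left _ _ hs']
    abel
  · have e : 𝒢.Lam Ψ t *ᵥ η = 𝒢.G *ᵥ X 𝒢.T - Y 𝒢.T := by
      have e1 : fromRows (0 : Matrix (Fin n) (Fin n) ℝ) (1 : Matrix (Fin n) (Fin n) ℝ) *ᵥ η =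
          Sum.elim (0 : Fin n → ℝ) η := by
        rw [fromRows_mulVec, zero_mulVec, one_mulVec]
      rw [Lam, ← mulVec_mulVec, e1, ← mulVec_mulVec, ← mulVec_mulVec, ← hc, fromCols_mulVec,
        neg_mulVec, one_mulVec, ← sub_eq_add_neg]
    rw [e, sub_eq_zero] at hη
    exact hη.symm

/-- Nonsingularity of `Λ(t)`, from convexity in the first control, concavity in the second, and the
absence of a linear dependence on the initial state along degenerate directions. -/
theorem isUnit_Lam_of_convex_concave (h : 𝒢.Standing)
    (hRu : ∀ᵐ t ∂(volume.restrict (Icc 0 𝒢.T)), IsUnit (𝒢.R t))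
    (hR : MatLInfty 𝒢.T (fun t => (𝒢.R t)⁻¹))
    {Ψ : ℝ → Matrix (Fin n ⊕ Fin n) (Fin n ⊕ Fin n) ℝ} (hΨ : 𝒢.IsFundamentalMatrix Ψ)
    {t : ℝ} (ht : t ∈ Icc 0 𝒢.T)
    (h₁ : ∀ p ∈ 𝒢.onlyFirst t, 0 ≤ costForm h ht p p ∧ (costForm h ht p p = 0 →
      (∀ q ∈ 𝒢.onlySecond t, costForm h ht p q = 0) →
      ∀ q : 𝒢.admissible t, q.1.2 = 0 → costForm h ht p q = 0))
    (h₂ : ∀ p ∈ 𝒢.onlySecond t, costForm h ht p p ≤ 0 ∧ (costForm h ht p p = 0 →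
      (∀ q ∈ 𝒢.onlyFirst t, costForm h ht p q = 0) →
      ∀ q : 𝒢.admissible t, q.1.2 = 0 → costForm h ht p q = 0)) :
    IsUnit (𝒢.Lam Ψ t) := by
  rw [← mulVec_injective_iff_isUnit]
  refine (injective_iff_map_eq_zero (Matrix.mulVecLin (𝒢.Lam Ψ t))).2 fun η hη => ?_
  rw [mulVecLin_apply] at hη
  obtain ⟨p, hp0, hp⟩ := exists_stationary_of_Lam_mulVec_eq_zero h hRu hR hΨ ht hη
  obtain ⟨p₁, hp₁0, hp₁u⟩ := exists_admissible h ht (0 : Fin n → ℝ)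
    (u := fun s => Sum.elim (p.1.2 s ∘ Sum.inl) 0) (by
      rintro (k | k)
      · exact p.2.1 (Sum.inl k)
      · exact MemLp.zero)
  have hp₁ : p₁ ∈ 𝒢.onlyFirst t := ⟨hp₁0, fun s j => by rw [hp₁u]; rfl⟩
  have hp₂ : p - p₁ ∈ 𝒢.onlySecond t := by
    refine ⟨?_, fun s j => ?_⟩
    · simp [hp0, hp₁0]
    · simp [hp₁u]
  have hadd : p₁ + (p - p₁) = p := by abel
  have key := orthogonal_of_add_orthogonal (costForm_comm h ht) (fun q hq => (h₁ q hq).1)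
    (fun q hq => (h₂ q hq).1) hp₁ hp₂
    (fun q hq => by rw [hadd, hp, hq.1, dotProduct_zero])
    (fun q hq => by rw [hadd, hp, hq.1, dotProduct_zero])
  refine dotProduct_eq_zero η fun x => ?_
  obtain ⟨q, hqx, hqu⟩ := exists_admissible h ht x (u := 0) (fun _ => MemLp.zero)
  rw [← hqx, ← hp q, ← hadd, map_add, LinearMap.add_apply,
    (h₁ p₁ hp₁).2 key.1.1 key.1.2 q hqu, (h₂ _ hp₂).2 key.2.1 key.2.2 q hqu, add_zero]

end LQGame

/-! ### Square-integrable random inputs -/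

section Random

variable {Ω : Type*} {mΩ : MeasurableSpace Ω} {μ : Measure Ω}

theorem MeasureTheory.MemLp.ae_memLp_two_left {α : Type*} {mα : MeasurableSpace α} {ν : Measure α}
    [SFinite ν] [SFinite μ] {f : α × Ω → ℝ} (hf : MemLp f 2 (ν.prod μ)) :
    ∀ᵐ ω ∂μ, MemLp (fun s => f (s, ω)) 2 ν := by
  filter_upwards [hf.1.prodMk_right, hf.integrable_sq.prod_left_ae] with ω h1 h2
  exact (memLp_two_iff_integrable_sq h1).2 h2

theorem sq_integral_abs_le {α : Type*} {mα : MeasurableSpace α} {ν : Measure α}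
    [IsFiniteMeasure ν] {f : α → ℝ} (hf : MemLp f 2 ν) :
    (∫ s, |f s| ∂ν) ^ 2 ≤ ν.real univ * ∫ s, f s ^ 2 ∂ν := by
  have hi : Integrable (fun s => |f s|) ν := (hf.integrable one_le_two).abs
  have hs : Integrable (fun s => f s ^ 2) ν := hf.integrable_sq
  have key : ∀ l : ℝ, 0 ≤ ν.real univ * (l * l) + (-2 * ∫ s, |f s| ∂ν) * l + ∫ s, f s ^ 2 ∂ν := by
    intro l
    have h0 : 0 ≤ ∫ s, (|f s| - l) ^ 2 ∂ν := integral_nonneg fun s => sq_nonneg _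
    have h1 : ∫ s, (|f s| - l) ^ 2 ∂ν =
        ∫ s, (f s ^ 2 - 2 * l * |f s| + l ^ 2) ∂ν := by
      congr 1
      ext s
      rw [← sq_abs (f s)]
      ring
    have h2 : Integrable (fun s => f s ^ 2 - 2 * l * |f s|) ν := hs.sub (hi.const_mul _)
    rw [h1, integral_add h2 (integrable_const _),
      integral_sub hs (hi.const_mul _), integral_const_mul, integral_const, smul_eq_mul] at h0
    nlinarith
  have := discrim_le_zero key
  rw [discrim] at this
  nlinarith

variable [IsFiniteMeasure μ] {t T : ℝ} {g : ℝ × Ω → ℝ}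

theorem sq_primitive_le {f : ℝ → ℝ} (hf : MemLp f 2 (volume.restrict (Icc t T))) {s : ℝ}
    (hs : s ∈ Icc t T) :
    (∫ r in t..s, f r) ^ 2 ≤ (T - t) * ∫ r in Icc t T, f r ^ 2 := by
  have hi : IntegrableOn f (Icc t T) := hf.integrable one_le_two
  have h1 : |∫ r in t..s, f r| ≤ ∫ r in Icc t T, |f r| := by
    rw [intervalIntegral.integral_of_le hs.1]
    refine abs_integral_le_integral_abs.trans ?_
    exact setIntegral_mono_set hi.abs (.of_forall fun _ => abs_nonneg _)
      (.of_forall fun r hr => ⟨hr.1.le, hr.2.trans hs.2⟩)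
  have h2 := sq_integral_abs_le hf
  rw [measureReal_restrict_apply_univ, Real.volume_real_Icc_of_le (hs.1.trans hs.2)] at h2
  rw [← sq_abs]
  exact (pow_le_pow_left₀ (abs_nonneg _) h1 2).trans h2

/-- Joint measurability of a primitive: `∫_t^s` is rewritten as an integral over all of `[t,T]` of
a jointly measurable function of `(s, ω)` and the integration variable. -/
theorem aestronglyMeasurable_primitive
    (hg : AEStronglyMeasurable g ((volume.restrict (Icc t T)).prod μ)) :
    AEStronglyMeasurable (fun z : ℝ × Ω => ∫ r in t..z.1, g (r, z.2))
      ((volume.restrict (Icc t T)).prod μ) := by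
  set ν := volume.restrict (Icc t T) with hν
  let F : ℝ × Ω → ℝ → ℝ := fun z r => {q : (ℝ × Ω) × ℝ | t < q.2 ∧ q.2 ≤ q.1.1}.indicator
    (fun q => hg.mk g (q.2, q.1.2)) (z, r)
  have hF : StronglyMeasurable fun z => ∫ r, F z r ∂ν := by
    refine StronglyMeasurable.integral_prod_right (f := F) ?_
    refine StronglyMeasurable.indicator (f := fun q : (ℝ × Ω) × ℝ => hg.mk g (q.2, q.1.2))
      (hg.stronglyMeasurable_mk.comp_measurable (by fun_prop)) ?_
    exact (measurableSet_lt measurable_const measurable_snd).inter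
      (measurableSet_le measurable_snd measurable_fst.fst)
  refine ⟨_, hF, ?_⟩
  have hsec : ∀ᵐ ω ∂μ, ∀ᵐ r ∂ν, g (r, ω) = hg.mk g (r, ω) := by
    have h2 : ∀ᵐ z ∂(μ.prod ν), g z.swap = hg.mk g z.swap :=
      Measure.measurePreserving_swap.quasiMeasurePreserving.ae hg.ae_eq_mk
    exact Measure.ae_ae_of_ae_prod h2
  have h1 : ∀ᵐ z ∂(ν.prod μ), z.1 ∈ Icc t T :=
    Measure.quasiMeasurePreserving_fst.ae (ae_restrict_mem measurableSet_Icc)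
  filter_upwards [h1, Measure.quasiMeasurePreserving_snd.ae hsec] with z hz1 hz2
  have hIoc : Ioc t z.1 ⊆ Icc t T := fun r hr => ⟨hr.1.le, hr.2.trans hz1.2⟩
  calc ∫ r in t..z.1, g (r, z.2) = ∫ r in Ioc t z.1, g (r, z.2) :=
        intervalIntegral.integral_of_le hz1.1
    _ = ∫ r in Ioc t z.1, g (r, z.2) ∂ν := by
        rw [hν, Measure.restrict_restrict measurableSet_Ioc, inter_eq_left.2 hIoc]
    _ = ∫ r, (Ioc t z.1).indicator (fun r => g (r, z.2)) r ∂ν :=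
        (integral_indicator measurableSet_Ioc).symm
    _ = ∫ r, F z r ∂ν := by
        refine integral_congr_ae ?_
        filter_upwards [hz2] with r hr
        by_cases hm : r ∈ Ioc t z.1
        · have hm' : (z, r) ∈ {q : (ℝ × Ω) × ℝ | t < q.2 ∧ q.2 ≤ q.1.1} := hm
          simp only [F]
          rw [indicator_of_mem hm, indicator_of_mem hm', hr]
        · have hm' : (z, r) ∉ {q : (ℝ × Ω) × ℝ | t < q.2 ∧ q.2 ≤ q.1.1} := hm
          simp only [F]
          rw [indicator_of_notMem hm, indicator_of_notMem hm']

theorem integrable_sectional_sq (hg : MemLp g 2 ((volume.restrict (Icc t T)).prod μ)) :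
    Integrable (fun ω => (T - t) * ∫ r in Icc t T, g (r, ω) ^ 2) μ :=
  hg.integrable_sq.integral_prod_right.const_mul _

theorem memLp_two_primitive (hg : MemLp g 2 ((volume.restrict (Icc t T)).prod μ)) :
    MemLp (fun z : ℝ × Ω => ∫ r in t..z.1, g (r, z.2)) 2 ((volume.restrict (Icc t T)).prod μ) := by
  have hm := aestronglyMeasurable_primitive hg.1
  rw [memLp_two_iff_integrable_sq hm]
  refine ((integrable_sectional_sq hg).comp_snd (volume.restrict (Icc t T))).mono' (hm.pow 2) ?_
  have h1 : ∀ᵐ z ∂((volume.restrict (Icc t T)).prod μ), z.1 ∈ Icc t T :=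
    Measure.quasiMeasurePreserving_fst.ae (ae_restrict_mem measurableSet_Icc)
  filter_upwards [h1, Measure.quasiMeasurePreserving_snd.ae hg.ae_memLp_two_left] with z hz1 hz2
  rw [Real.norm_eq_abs, abs_of_nonneg (sq_nonneg _)]
  exact sq_primitive_le hz2 hz1

theorem memLp_two_primitive_right (htT : t ≤ T)
    (hg : MemLp g 2 ((volume.restrict (Icc t T)).prod μ)) :
    MemLp (fun ω => ∫ r in t..T, g (r, ω)) 2 μ := by
  have hm : AEStronglyMeasurable (fun ω => ∫ r in t..T, g (r, ω)) μ := by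
    simp only [intervalIntegral.integral_of_le htT, ← integral_Icc_eq_integral_Ioc]
    exact (hg.integrable one_le_two).integral_prod_right.1
  rw [memLp_two_iff_integrable_sq hm]
  refine (integrable_sectional_sq hg).mono' (hm.pow 2) ?_
  filter_upwards [hg.ae_memLp_two_left] with ω hω
  rw [Real.norm_eq_abs, abs_of_nonneg (sq_nonneg _)]
  exact sq_primitive_le hω ⟨htT, le_rfl⟩

end Random

namespace LQGame

variable {n m₁ m₂ : ℕ} {𝒢 : LQGame n m₁ m₂}
  {Ω : Type*} {mΩ : MeasurableSpace Ω} {μ : Measure Ω}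

/-- The pathwise cost under a square-integrable random input is integrable. -/
theorem integrable_costForm [IsFiniteMeasure μ] (h : 𝒢.Standing) {t : ℝ} (ht : t ∈ Icc 0 𝒢.T)
    {x : Fin n → ℝ} {U : ℝ → Ω → Fin m₁ ⊕ Fin m₂ → ℝ}
    (hU : ∀ k, MemLp (fun z : ℝ × Ω => U z.1 z.2 k) 2 ((volume.restrict (Icc t 𝒢.T)).prod μ))
    {p : Ω → 𝒢.admissible t}
    (hp : ∀ᵐ ω ∂μ, (p ω).1.1 t = x ∧ (p ω).1.2 = fun s => U s ω) :
    Integrable (fun ω => costForm h ht (p ω) (p ω)) μ := by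
  obtain ⟨Φ, Z, hΦ, hZ, hZΦ⟩ := h.exists_transition
  have hT0 := h.T_pos.le
  set ν := volume.restrict (Icc t 𝒢.T) with hν
  have hlift {ι κ : Type} {M : ℝ → Matrix ι κ ℝ} (hM : MatLInfty 𝒢.T M) (i j) :
      MemLp (fun z : ℝ × Ω => M z.1 i j) ∞ (ν.prod μ) :=
    ((hM i j).mono_measure (restrict_Icc_le ht.1)).comp_fst μ
  have hZB : MatLInfty 𝒢.T (fun s => Z s * 𝒢.B s) :=
    (MatLInfty.of_continuousOn (hZ.continuousOn hT0)).mul h.B_bdd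
  have hg (i) : MemLp (fun z : ℝ × Ω => ((Z z.1 * 𝒢.B z.1) *ᵥ U z.1 z.2) i) 2 (ν.prod μ) :=
    memLp_mulVec (hlift hZB) hU i
  let X (s : ℝ) (ω : Ω) : Fin n → ℝ := 𝒢.variationFormula Φ Z t x (fun s => U s ω) s
  have hXm (i) : MemLp (fun z : ℝ × Ω => X z.1 z.2 i) 2 (ν.prod μ) := by
    refine memLp_mulVec (W := fun z : ℝ × Ω => Φ z.1)
      (z := fun z : ℝ × Ω => Z t *ᵥ x + fun i => ∫ r in t..z.1, ((Z r * 𝒢.B r) *ᵥ U r z.2) i)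
      (hlift (.of_continuousOn (hΦ.continuousOn hT0))) (fun i => ?_) i
    exact (memLp_const ((Z t *ᵥ x) i)).add (memLp_two_primitive (hg i))
  have hXT (i) : MemLp (fun ω => X 𝒢.T ω i) 2 μ := by
    refine memLp_mulVec (W := fun _ : Ω => Φ 𝒢.T)
      (z := fun ω => Z t *ᵥ x + fun i => ∫ r in t..𝒢.T, ((Z r * 𝒢.B r) *ᵥ U r ω) i)
      (fun i j => memLp_top_const _) (fun i => ?_) i
    exact (memLp_const ((Z t *ᵥ x) i)).add (memLp_two_primitive_right ht.2 (hg i))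
  have hz (k) : MemLp (fun z : ℝ × Ω => Sum.elim (X z.1 z.2) (U z.1 z.2) k) 2 (ν.prod μ) := by
    rcases k with k | k
    · exact hXm k
    · exact hU k
  have hrun := (integrable_mulVec_dotProduct (hlift h.weight_bdd) hz hz).integral_prod_right
  have hterm := integrable_mulVec_dotProduct (W := fun _ : Ω => 𝒢.G)
    (fun i j => memLp_top_const _) hXT hXT
  refine (hterm.add hrun).congr ?_
  filter_upwards [hp] with ω hω
  have hX (s) (hs : s ∈ Icc t 𝒢.T) : (p ω).1.1 s = X s ω := by
    have := eq_variationFormula hZ hZΦ ht (p ω).2.2 hs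
    rwa [hω.1, hω.2] at this
  rw [Pi.add_apply, costForm_apply, hX 𝒢.T ⟨ht.2, le_rfl⟩, intervalIntegral.integral_of_le ht.2,
    ← integral_Icc_eq_integral_Ioc]
  congr 1
  refine setIntegral_congr_fun measurableSet_Icc fun s hs => ?_
  simp only [stack]
  rw [hX s hs, hω.2]

theorem J_eq_integral_costForm (h : 𝒢.Standing) {t : ℝ} (ht : t ∈ Icc 0 𝒢.T) {x : Fin n → ℝ}
    {u₁ : ℝ → Ω → Fin m₁ → ℝ} {u₂ : ℝ → Ω → Fin m₂ → ℝ} {p : Ω → 𝒢.admissible t}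
    (hp : ∀ᵐ ω ∂μ, (p ω).1.1 t = x ∧ (p ω).1.2 = fun s => Sum.elim (u₁ s ω) (u₂ s ω)) :
    𝒢.J μ t x u₁ u₂ = ∫ ω, costForm h ht (p ω) (p ω) ∂μ := by
  refine integral_congr_ae ?_
  filter_upwards [hp] with ω hω
  exact pathwise_cost_eq h ht (p ω) hω.1 hω.2

/-- Along the line `l ↦ l v + u` in a deterministic direction `v` the functional `J` is a quadratic
polynomial; all its coefficients are genuine integrals. -/
theorem J_add_smul [IsProbabilityMeasure μ] (h : 𝒢.Standing) {t : ℝ} (ht : t ∈ Icc 0 𝒢.T)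
    (x : Fin n → ℝ) {u₁ : ℝ → Ω → Fin m₁ → ℝ} {u₂ : ℝ → Ω → Fin m₂ → ℝ}
    (hu₁ : ∀ k, MemLp (fun z : ℝ × Ω => u₁ z.1 z.2 k) 2 ((volume.restrict (Icc t 𝒢.T)).prod μ))
    (hu₂ : ∀ k, MemLp (fun z : ℝ × Ω => u₂ z.1 z.2 k) 2 ((volume.restrict (Icc t 𝒢.T)).prod μ))
    (v : 𝒢.admissible t) (hv : v.1.1 t = 0) :
    ∃ p : Ω → 𝒢.admissible t,
      (∀ᵐ ω ∂μ, (p ω).1.1 t = x ∧ (p ω).1.2 = fun s => Sum.elim (u₁ s ω) (u₂ s ω)) ∧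
      ∀ l : ℝ, 𝒢.J μ t x (fun s ω => l • (v.1.2 s ∘ Sum.inl) + u₁ s ω)
          (fun s ω => l • (v.1.2 s ∘ Sum.inr) + u₂ s ω) =
        l ^ 2 * costForm h ht v v + 2 * l * ∫ ω, costForm h ht v (p ω) ∂μ +
          ∫ ω, costForm h ht (p ω) (p ω) ∂μ := by
  classical
  set ν := volume.restrict (Icc t 𝒢.T) with hν
  have hU (k) : MemLp (fun z : ℝ × Ω => Sum.elim (u₁ z.1 z.2) (u₂ z.1 z.2) k) 2 (ν.prod μ) := by
    rcases k with k | k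
    · exact hu₁ k
    · exact hu₂ k
  have hex : ∀ᵐ ω ∂μ, ∃ q : 𝒢.admissible t,
      q.1.1 t = x ∧ q.1.2 = fun s => Sum.elim (u₁ s ω) (u₂ s ω) := by
    filter_upwards [ae_all_iff.2 fun k => (hU k).ae_memLp_two_left] with ω hω
    exact exists_admissible h ht x hω
  let p : Ω → 𝒢.admissible t := fun ω =>
    if hq : ∃ q : 𝒢.admissible t, q.1.1 t = x ∧ q.1.2 = fun s => Sum.elim (u₁ s ω) (u₂ s ω)
    then hq.choose else 0
  have hp : ∀ᵐ ω ∂μ, (p ω).1.1 t = x ∧ (p ω).1.2 = fun s => Sum.elim (u₁ s ω) (u₂ s ω) := by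
    filter_upwards [hex] with ω hω
    simp only [p, dif_pos hω]
    exact hω.choose_spec
  have hpl (l : ℝ) : ∀ᵐ ω ∂μ, (l • v + p ω).1.1 t = x ∧ (l • v + p ω).1.2 =
      fun s => Sum.elim (l • (v.1.2 s ∘ Sum.inl) + u₁ s ω) (l • (v.1.2 s ∘ Sum.inr) + u₂ s ω) := by
    filter_upwards [hp] with ω hω
    refine ⟨by simp [hv, hω.1], ?_⟩
    ext s (k | k) <;> simp [hω.2]
  have hUl (l : ℝ) (k) : MemLp (fun z : ℝ × Ω => Sum.elim (l • (v.1.2 z.1 ∘ Sum.inl) + u₁ z.1 z.2)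
      (l • (v.1.2 z.1 ∘ Sum.inr) + u₂ z.1 z.2) k) 2 (ν.prod μ) := by
    have h1 := (((v.2.1 k).const_mul l).comp_fst μ).add (hU k)
    rcases k with k | k <;> exact h1
  have hexp (l : ℝ) (ω : Ω) : costForm h ht (l • v + p ω) (l • v + p ω) =
      l ^ 2 * costForm h ht v v + 2 * l * costForm h ht v (p ω) + costForm h ht (p ω) (p ω) := by
    simp only [map_add, LinearMap.add_apply, map_smul, LinearMap.smul_apply, smul_eq_mul,
      costForm_comm h ht (p ω) v]
    ring
  have hi0 : Integrable (fun ω => costForm h ht (p ω) (p ω)) μ := integrable_costForm h ht hU hp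
  have hicross : Integrable (fun ω => costForm h ht v (p ω)) μ := by
    -- The cross term is obtained by polarization from two diagonal terms.
    have h1 := integrable_costForm h ht (hUl 1) (hpl 1)
    have h2 := ((h1.sub hi0).sub (integrable_const (costForm h ht v v))).const_mul (1 / 2)
    refine h2.congr (.of_forall fun ω => ?_)
    simp only [Pi.sub_apply, hexp]
    ring
  refine ⟨p, hp, fun l => ?_⟩
  rw [J_eq_integral_costForm h ht (hpl l)]
  simp only [hexp]
  have hsum : Integrable
      (fun ω => l ^ 2 * costForm h ht v v + 2 * l * costForm h ht v (p ω)) μ :=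
    (integrable_const _).add (hicross.const_mul _)
  rw [integral_add hsum hi0,
    integral_add (integrable_const _) (hicross.const_mul _), integral_const, integral_const_mul,
    probReal_univ, one_smul]

end LQGame

namespace LQGame

variable {n m₁ m₂ : ℕ} {𝒢 : LQGame n m₁ m₂}
  {Ω : Type*} {mΩ : MeasurableSpace Ω} {μ : Measure Ω} {ℱ : Filtration ℝ≥0 mΩ}

/-! ### Controls -/

/-- Progressive measurability up to time `T` makes a control jointly measurable on `[t,T] × Ω`. -/
theorem memLp_of_mem_Control [IsProbabilityMeasure μ] {m : ℕ} {t : ℝ} (ht : t ∈ Icc 0 𝒢.T)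
    {u : ℝ → Ω → Fin m → ℝ} (hu : u ∈ 𝒢.Control μ ℱ m t) (k : Fin m) :
    MemLp (fun z : ℝ × Ω => u z.1 z.2 k) 2 ((volume.restrict (Icc t 𝒢.T)).prod μ) := by
  set ν := volume.restrict (Icc t 𝒢.T) with hν
  obtain ⟨hprog, hfin⟩ := hu
  set τ : ℝ≥0 := 𝒢.T.toNNReal with hτ
  have hclip : Measurable[_, Subtype.instMeasurableSpace.prod (ℱ τ)]
      (fun z : ℝ × Ω => ((⟨min z.1.toNNReal τ, mem_Iic.2 (min_le_right _ _)⟩ : Iic τ), z.2)) := by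
    have h1 : Measurable (fun z : ℝ × Ω => (⟨min z.1.toNNReal τ, mem_Iic.2 (min_le_right _ _)⟩ : Iic τ)) :=
      Measurable.subtype_mk (by fun_prop)
    have h2 : Measurable[_, ℱ τ] (fun z : ℝ × Ω => z.2) := measurable_snd.mono le_rfl (ℱ.le τ)
    exact h1.prodMk h2
  have hmeas : StronglyMeasurable (fun z : ℝ × Ω => u ((min z.1.toNNReal τ : ℝ≥0) : ℝ) z.2) :=
    (hprog τ).comp_measurable hclip
  have heq : ∀ᵐ z ∂(ν.prod μ), u ((min z.1.toNNReal τ : ℝ≥0) : ℝ) z.2 = u z.1 z.2 := by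
    have h1 : ∀ᵐ z ∂(ν.prod μ), z.1 ∈ Icc t 𝒢.T :=
      Measure.quasiMeasurePreserving_fst.ae (ae_restrict_mem measurableSet_Icc)
    filter_upwards [h1] with z hz
    have : ((min z.1.toNNReal τ : ℝ≥0) : ℝ) = z.1 := by
      rw [hτ, min_eq_left (Real.toNNReal_le_toNNReal hz.2),
        Real.coe_toNNReal _ (ht.1.trans hz.1)]
    rw [this]
  have hae : AEStronglyMeasurable (fun z : ℝ × Ω => u z.1 z.2) (ν.prod μ) :=
    ⟨_, hmeas, heq.mono fun _ h => h.symm⟩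
  have haek (j) : AEStronglyMeasurable (fun z : ℝ × Ω => u z.1 z.2 j) (ν.prod μ) :=
    (continuous_apply j).comp_aestronglyMeasurable hae
  rw [memLp_two_iff_integrable_sq (haek k)]
  refine ⟨(haek k).pow 2, ?_⟩
  rw [hasFiniteIntegral_iff_ofReal (.of_forall fun z => sq_nonneg _)]
  have hdot : AEMeasurable (fun z : ℝ × Ω => ENNReal.ofReal (u z.1 z.2 ⬝ᵥ u z.1 z.2))
      (ν.prod μ) := by
    refine AEMeasurable.ennreal_ofReal ?_
    simp only [dotProduct]
    exact Finset.aemeasurable_fun_sum _ fun j _ => (haek j).aemeasurable.mul (haek j).aemeasurable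
  refine lt_of_le_of_lt ?_ (lt_of_eq_of_lt (lintegral_prod_symm _ hdot) hfin)
  refine lintegral_mono fun z => ENNReal.ofReal_le_ofReal ?_
  rw [sq]
  exact Finset.single_le_sum (f := fun j => u z.1 z.2 j * u z.1 z.2 j)
    (fun j _ => mul_self_nonneg _) (Finset.mem_univ k)

/-- A square-integrable strongly measurable function of time is a (deterministic) control. -/
theorem deterministic_mem_Control [IsProbabilityMeasure μ] {m : ℕ} {t : ℝ}
    {v : ℝ → Fin m → ℝ} (hv : StronglyMeasurable v)
    (hv2 : ∀ k, MemLp (fun s => v s k) 2 (volume.restrict (Icc t 𝒢.T))) :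
    (fun s _ => v s) ∈ 𝒢.Control μ ℱ m t := by
  refine ⟨fun i => ?_, ?_⟩
  · have h1 : StronglyMeasurable fun r : Iic i => v ((r : ℝ≥0) : ℝ) :=
      hv.comp_measurable (by fun_prop)
    exact h1.comp_measurable measurable_fst
  · have hi : Integrable (fun s => v s ⬝ᵥ v s) (volume.restrict (Icc t 𝒢.T)) := by
      simp only [dotProduct]
      exact integrable_finsetSum _ fun k _ => (hv2 k).integrable_mul (hv2 k)
    have := (hasFiniteIntegral_iff_ofReal (.of_forall fun s =>
      Finset.sum_nonneg fun k _ => mul_self_nonneg (v s k))).1 hi.2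
    simpa [dotProduct] using this

/-- Every admissible pair has a version whose control is strongly measurable at all times. -/
theorem exists_stronglyMeasurable_version (h : 𝒢.Standing) {t : ℝ} (ht : t ∈ Icc 0 𝒢.T)
    (p : 𝒢.admissible t) :
    ∃ p' : 𝒢.admissible t, p'.1.1 = p.1.1 ∧ (∀ k, StronglyMeasurable fun s => p'.1.2 s k) ∧
      (∀ k, (∀ s, p.1.2 s k = 0) → ∀ s, p'.1.2 s k = 0) ∧
      ∀ q, costForm h ht p' q = costForm h ht p q := by
  classical
  let u : ℝ → Fin m₁ ⊕ Fin m₂ → ℝ := fun s k =>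
    if ∀ s, p.1.2 s k = 0 then 0 else (p.2.1 k).aestronglyMeasurable.mk _ s
  have hu : ∀ᵐ s ∂(volume.restrict (Icc t 𝒢.T)), p.1.2 s = u s := by
    have := ae_all_iff.2 fun k => (p.2.1 k).aestronglyMeasurable.ae_eq_mk
    filter_upwards [this] with s hs
    ext k
    simp only [u]
    split_ifs with hk
    · exact hk s
    · exact hs k
  refine ⟨⟨(p.1.1, u), fun k => (memLp_congr_ae (hu.mono fun s hs => congrFun hs k)).1 (p.2.1 k),
    p.2.2.congr_ae ht.2 (hu.mono fun s hs => by simp only [hs])⟩, rfl, fun k => ?_,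
    fun k hk s => if_pos hk, fun q => ?_⟩
  · by_cases hk : ∀ s, p.1.2 s k = 0
    · simp only [u, if_pos hk]
      exact stronglyMeasurable_const
    · simp only [u, if_neg hk]
      exact (p.2.1 k).aestronglyMeasurable.stronglyMeasurable_mk
  · rw [costForm_apply, costForm_apply]
    congr 1
    refine intervalIntegral.integral_congr_ae ?_
    filter_upwards [(ae_restrict_iff' measurableSet_Icc).1 hu] with s hs hst
    rw [uIoc_of_le ht.2] at hst
    simp only [stack, hs ⟨hst.1.le, hst.2⟩]

/-! ### Consequences of finite values -/

theorem exists_lower_bound_of_lowerValue_ne_bot {t : ℝ} {x : Fin n → ℝ}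
    (hV : 𝒢.lowerValue μ ℱ t x ≠ ⊥) :
    ∃ u₂ ∈ 𝒢.Control μ ℱ m₂ t, ∃ c : ℝ, ∀ u₁ ∈ 𝒢.Control μ ℱ m₁ t, c ≤ 𝒢.J μ t x u₁ u₂ := by
  obtain ⟨c, -, hc⟩ := EReal.lt_iff_exists_real_btwn.1 (bot_lt_iff_ne_bot.2 hV)
  obtain ⟨u₂, hu₂⟩ := lt_iSup_iff.1 hc
  obtain ⟨hu₂, hlt⟩ := lt_iSup_iff.1 hu₂
  exact ⟨u₂, hu₂, c, fun u₁ hu₁ => by exact_mod_cast (hlt.le.trans (iInf₂_le u₁ hu₁))⟩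

theorem exists_upper_bound_of_upperValue_ne_top {t : ℝ} {x : Fin n → ℝ}
    (hV : 𝒢.upperValue μ ℱ t x ≠ ⊤) :
    ∃ u₁ ∈ 𝒢.Control μ ℱ m₁ t, ∃ c : ℝ, ∀ u₂ ∈ 𝒢.Control μ ℱ m₂ t, 𝒢.J μ t x u₁ u₂ ≤ c := by
  obtain ⟨c, hc, -⟩ := EReal.lt_iff_exists_real_btwn.1 (lt_top_iff_ne_top.2 hV)
  obtain ⟨u₁, hu₁⟩ := iInf_lt_iff.1 hc
  obtain ⟨hu₁, hlt⟩ := iInf_lt_iff.1 hu₁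
  exact ⟨u₁, hu₁, c, fun u₂ hu₂ => by
    exact_mod_cast ((le_iSup₂ (f := fun u₂ _ => ((𝒢.J μ t x u₁ u₂ : ℝ) : EReal)) u₂ hu₂).trans hlt.le)⟩

/-- If the lower value is not `-∞`, the cost is convex in the first control, and a degenerate
direction of the first player that does not interact with the second player's controls does not
interact with the initial state either. -/
theorem convex_of_lowerValue_ne_bot [IsProbabilityMeasure μ] (h : 𝒢.Standing) {t : ℝ}
    (ht : t ∈ Icc 0 𝒢.T) (hV : ∀ x, 𝒢.lowerValue μ ℱ t x ≠ ⊥) {p : 𝒢.admissible t}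
    (hp : p ∈ 𝒢.onlyFirst t) :
    0 ≤ costForm h ht p p ∧ (costForm h ht p p = 0 →
      (∀ q ∈ 𝒢.onlySecond t, costForm h ht p q = 0) →
      ∀ q : 𝒢.admissible t, q.1.2 = 0 → costForm h ht p q = 0) := by
  obtain ⟨p', hp'X, hp'm, hp'0, hp'⟩ := exists_stronglyMeasurable_version h ht p
  have hpp : costForm h ht p' p' = costForm h ht p p := by
    rw [hp', costForm_comm, hp']
  have hinr (s) : p'.1.2 s ∘ Sum.inr = 0 := by
    ext j
    exact hp'0 _ (fun s => hp.2 s j) s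
  -- For each `x`, the player-two control witnessing `V⁻(t,x) > -∞` bounds a quadratic polynomial.
  have main (x : Fin n → ℝ) : ∃ (u₂ : ℝ → Ω → Fin m₂ → ℝ) (P : Ω → 𝒢.admissible t),
      (∀ᵐ ω ∂μ, (P ω).1.1 t = x ∧ (P ω).1.2 = fun s => Sum.elim (0 : Fin m₁ → ℝ) (u₂ s ω)) ∧
      (0 ≤ costForm h ht p p ∧ (costForm h ht p p = 0 →
        ∫ ω, costForm h ht p (P ω) ∂μ = 0)) := by
    obtain ⟨u₂, hu₂, c, hc⟩ := exists_lower_bound_of_lowerValue_ne_bot (hV x)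
    obtain ⟨P, hP, hJ⟩ := J_add_smul h ht x (u₁ := fun _ _ => 0) (fun k => MemLp.zero)
      (memLp_of_mem_Control ht hu₂) p' (by rw [hp'X, hp.1])
    refine ⟨u₂, P, hP, ?_⟩
    have := nonneg_and_eq_zero_of_quadratic_bounded_below (c := c)
      (a := costForm h ht p p) (β := ∫ ω, costForm h ht p (P ω) ∂μ)
      (γ := ∫ ω, costForm h ht (P ω) (P ω) ∂μ) fun l => by
        have h1 := hJ l
        simp only [hinr, smul_zero, zero_add, add_zero, hpp, hp'] at h1
        rw [← h1]
        refine hc _ (deterministic_mem_Control ?_ fun k => ?_)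
        · exact (measurable_pi_lambda _ fun k => (hp'm (Sum.inl k)).measurable).stronglyMeasurable.const_smul l
        · exact (p'.2.1 (Sum.inl k)).const_mul l
    exact this
  refine ⟨(main 0).choose_spec.choose_spec.2.1, fun h0 hcross q hq => ?_⟩
  obtain ⟨u₂, P, hP, -, hβ⟩ := main (q.1.1 t)
  have : ∀ᵐ ω ∂μ, costForm h ht p (P ω) = costForm h ht p q := by
    filter_upwards [hP] with ω hω
    have hmem : P ω - q ∈ 𝒢.onlySecond t := by
      refine ⟨?_, fun s j => ?_⟩
      · simp [hω.1]
      · simp [hω.2, hq]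
    have h1 := hcross _ hmem
    rwa [map_sub, sub_eq_zero] at h1
  have h2 := hβ h0
  rwa [integral_congr_ae this, integral_const, probReal_univ, one_smul] at h2

/-- The counterpart of `convex_of_lowerValue_ne_bot` for the second player. -/
theorem concave_of_upperValue_ne_top [IsProbabilityMeasure μ] (h : 𝒢.Standing) {t : ℝ}
    (ht : t ∈ Icc 0 𝒢.T) (hV : ∀ x, 𝒢.upperValue μ ℱ t x ≠ ⊤) {p : 𝒢.admissible t}
    (hp : p ∈ 𝒢.onlySecond t) :
    costForm h ht p p ≤ 0 ∧ (costForm h ht p p = 0 →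
      (∀ q ∈ 𝒢.onlyFirst t, costForm h ht p q = 0) →
      ∀ q : 𝒢.admissible t, q.1.2 = 0 → costForm h ht p q = 0) := by
  obtain ⟨p', hp'X, hp'm, hp'0, hp'⟩ := exists_stronglyMeasurable_version h ht p
  have hpp : costForm h ht p' p' = costForm h ht p p := by
    rw [hp', costForm_comm, hp']
  have hinl (s) : p'.1.2 s ∘ Sum.inl = 0 := by
    ext j
    exact hp'0 _ (fun s => hp.2 s j) s
  have main (x : Fin n → ℝ) : ∃ (u₁ : ℝ → Ω → Fin m₁ → ℝ) (P : Ω → 𝒢.admissible t),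
      (∀ᵐ ω ∂μ, (P ω).1.1 t = x ∧ (P ω).1.2 = fun s => Sum.elim (u₁ s ω) (0 : Fin m₂ → ℝ)) ∧
      (costForm h ht p p ≤ 0 ∧ (costForm h ht p p = 0 →
        ∫ ω, costForm h ht p (P ω) ∂μ = 0)) := by
    obtain ⟨u₁, hu₁, c, hc⟩ := exists_upper_bound_of_upperValue_ne_top (hV x)
    obtain ⟨P, hP, hJ⟩ := J_add_smul h ht x (u₂ := fun _ _ => 0) (memLp_of_mem_Control ht hu₁)
      (fun k => MemLp.zero) p' (by rw [hp'X, hp.1])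
    refine ⟨u₁, P, hP, ?_⟩
    have := nonneg_and_eq_zero_of_quadratic_bounded_below (c := -c)
      (a := -costForm h ht p p) (β := -∫ ω, costForm h ht p (P ω) ∂μ)
      (γ := -∫ ω, costForm h ht (P ω) (P ω) ∂μ) fun l => by
        have h1 := hJ l
        simp only [hinl, smul_zero, zero_add, add_zero, hpp, hp'] at h1
        have h2 := hc _ (deterministic_mem_Control (μ := μ) (ℱ := ℱ)
          (v := fun s => l • (p'.1.2 s ∘ Sum.inr))
          ((measurable_pi_lambda _ fun k => (hp'm (Sum.inr k)).measurable).stronglyMeasurable.const_smul l)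
          fun k => (p'.2.1 (Sum.inr k)).const_mul l)
        rw [h1] at h2
        linarith
    simpa using this
  refine ⟨(main 0).choose_spec.choose_spec.2.1, fun h0 hcross q hq => ?_⟩
  obtain ⟨u₁, P, hP, -, hβ⟩ := main (q.1.1 t)
  have : ∀ᵐ ω ∂μ, costForm h ht p (P ω) = costForm h ht p q := by
    filter_upwards [hP] with ω hω
    have hmem : P ω - q ∈ 𝒢.onlyFirst t := by
      refine ⟨?_, fun s j => ?_⟩
      · simp [hω.1]
      · simp [hω.2, hq]
    have h1 := hcross _ hmem
    rwa [map_sub, sub_eq_zero] at h1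
  have h2 := hβ h0
  rwa [integral_congr_ae this, integral_const, probReal_univ, one_smul] at h2

/-- Finite values make `Λ` nonsingular on all of `[0,T]`; at `T` itself `Λ = -I`. -/
theorem isUnit_Lam [IsProbabilityMeasure μ] (h : 𝒢.Standing)
    (hRu : ∀ᵐ t ∂(volume.restrict (Icc 0 𝒢.T)), IsUnit (𝒢.R t))
    (hR : MatLInfty 𝒢.T (fun t => (𝒢.R t)⁻¹)) (hV : 𝒢.FiniteValues μ ℱ)
    {Ψ : ℝ → Matrix (Fin n ⊕ Fin n) (Fin n ⊕ Fin n) ℝ} (hΨ : 𝒢.IsFundamentalMatrix Ψ)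
    {t : ℝ} (ht : t ∈ Icc 0 𝒢.T) : IsUnit (𝒢.Lam Ψ t) := by
  rcases ht.2.eq_or_lt with rfl | htT
  · rw [Lam_T h hR hΨ]
    exact isUnit_one.neg
  · have hV' := hV t ⟨ht.1, htT⟩
    exact isUnit_Lam_of_convex_concave h hRu hR hΨ ht
      (fun p hp => convex_of_lowerValue_ne_bot h ht (fun x => (hV' x).1.1) hp)
      (fun p hp => concave_of_upperValue_ne_top h ht (fun x => (hV' x).2.2) hp)

end LQGame

theorem mainTheorem4 {n m₁ m₂ : ℕ} (𝒢 : LQGame n m₁ m₂) (h𝒢 : 𝒢.Standing)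
    {Ω : Type*} {mΩ : MeasurableSpace Ω} (μ : Measure Ω) [IsProbabilityMeasure μ]
    (ℱ : Filtration ℝ≥0 mΩ)
    (hR₁₁ : MatStrictlyAbove 𝒢.T 𝒢.R₁₁ 0) (hR₂₂ : MatStrictlyAbove 𝒢.T 0 𝒢.R₂₂)
    (hV : 𝒢.FiniteValues μ ℱ) :
    (∀ᵐ t ∂(volume.restrict (Icc 0 𝒢.T)), IsUnit (𝒢.R t)) ∧
    (∃ Ψ, 𝒢.IsFundamentalMatrix Ψ) ∧
    ∃ P : ℝ → Matrix (Fin n) (Fin n) ℝ,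
      𝒢.IsRiccatiSolution P ∧
      (∀ P', 𝒢.IsRiccatiSolution P' → ∀ t ∈ Icc 0 𝒢.T, P' t = P t) ∧
      ∀ Ψ, 𝒢.IsFundamentalMatrix Ψ → ∀ t ∈ Icc 0 𝒢.T,
        IsUnit (Ψ t) ∧ IsUnit (𝒢.Lam Ψ t) ∧
        P t = -(𝒢.Lam Ψ t)⁻¹ *
          (fromCols 𝒢.G (-1 : Matrix (Fin n) (Fin n) ℝ) * (Ψ 𝒢.T * (Ψ t)⁻¹) *
            fromRows (1 : Matrix (Fin n) (Fin n) ℝ) (0 : Matrix (Fin n) (Fin n) ℝ)) := by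
  obtain ⟨hRu, hR⟩ := h𝒢.R_inv hR₁₁ hR₂₂
  obtain ⟨Ψ₀, hΨ₀⟩ := LQGame.exists_isFundamentalMatrix h𝒢 hR
  have hsol {Ψ} (hΨ : 𝒢.IsFundamentalMatrix Ψ) :=
    LQGame.isRiccatiSolution_of_isUnit_Lam h𝒢 hR hΨ
      fun t ht => LQGame.isUnit_Lam h𝒢 hRu hR hV hΨ ht
  have huniq {P P'} (hP : 𝒢.IsRiccatiSolution P) (hP' : 𝒢.IsRiccatiSolution P') {t : ℝ}
      (ht : t ∈ Icc 0 𝒢.T) : P t = P' t := by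
    obtain ⟨-, hd, hT⟩ := (LQGame.isRiccatiSolution_iff h𝒢).1 hP
    obtain ⟨-, hd', hT'⟩ := (LQGame.isRiccatiSolution_iff h𝒢).1 hP'
    exact LQGame.riccati_unique h𝒢 hR hd hd' (hT.trans hT'.symm) ht
  exact ⟨hRu, ⟨Ψ₀, hΨ₀⟩, _, hsol hΨ₀, fun P' hP' t ht => huniq hP' (hsol hΨ₀) ht,
    fun Ψ hΨ t ht => ⟨hΨ.isUnit h𝒢 hR ht, LQGame.isUnit_Lam h𝒢 hRu hR hV hΨ ht,
      huniq (hsol hΨ₀) (hsol hΨ) ht⟩⟩
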